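/- Theorem 2.1. Let $g>0$, $\rho_+>\rho_->0$, $\mu_\pm>0$ and $B\in\mathbb R$ (the magnetic field is vertical, $\bar B=(0,B)$). Put $[\rho]=\rho_+-\rho_-$, let $\rho(x)=\rho_+,\ \mu(x)=\mu_+$ for $x>0$ and $\rho(x)=\rho_-,\ \mu(x)=\mu_-$ for $x<0$, and write $\llbracket f\rrbracket=f(0^+)-f(0^-)$. For $\xi\in\mathbb R$ consider the normal-mode problem for a function $\psi:[-1,1]\to\mathbb R$ and a number $\lambda>0$: $\psi$ is four times continuously differentiable on $(-1,0)$ and on $(0,1)$, where it satisfies $$-\lambda^2\rho(|\xi|^2\psi-\psi'')=\mu\lambda(|\xi|^4\psi-2|\xi|^2\psi''+\psi'''')+|B|^2(-|\xi|^2\psi''+\psi''''),$$ together with the jump conditions at $0$ (all one-sided limits existing, and $\psi(0)$ being the common limit of $\psi$) $$\llbracket\psi\rrbracket=\llbracket\psi'\rrbracket=0,\qquad \llbracket\mu\lambda(|\xi|^2\psi+\psi'')+|B|^2\psi''\rrbracket=0,$$ $$\llbracket\mu\lambda(\psi'''-3|\xi|^2\psi')+|B|^2\psi'''\rrbracket=\llbracket\lambda^2\rho\psi'\rrbracket+g[\rho]|\xi|^2\psi(0),$$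 and the boundary conditions $\psi(\pm1)=\psi'(\pm1)=0$, where $\psi$ and $\psi'$ take these values continuously from inside $(-1,1)$. Define $|B|_c\ge0$ by $$|B|_c^2=\sup_{0\ne\psi\in H_0^1((-1,1))}\frac{g[\rho]\psi(0)^2}{\int_{-1}^1|\psi'|^2\,dx},$$ and, if $|B|<|B|_c$, define $|\xi|_{vc}^B\ge0$ by $$(|\xi|_{vc}^B)^2=\inf\frac{|B|^2\int_{-1}^1|\psi''|^2\,dx}{g[\rho]\psi(0)^2-|B|^2\int_{-1}^1|\psi'|^2\,dx},$$ the infimum being over all $\psi\in H_0^2((-1,1))$ for which the denominator is positive. Then: (i) If $|B|\ge|B|_c$, then for every $\xi\in\mathbb R$ the problem has no solution $(\psi,\lambda)$ with $\lambda>0$ and $\psi\not\equiv0$. (ii) If $|B|<|B|_c$, then for every $\xi\in\mathbb R$ with $|\xi|\le|\xi|_{vc}^B$ the problem has no solution $(\psi,\lambda)$ with $\lambda>0$ and $\psi\not\equiv0$. (iii) If $|B|<|B|_c$, then for every $\xi\in\mathbb R$ with $|\xi|>|\xi|_{vc}^B$ there is a solution $\psi=\psi(\xi,\cdot)$, $\lambda=\lambda(\xi)>0$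 of the problem, and these can be chosen such that $\psi(-\xi,\cdot)=\psi(\xi,\cdot)$ and $\lambda(-\xi)=\lambda(\xi)$, the function $\psi(\xi,\cdot)$ is smooth on $(-1,0)$ and on $(0,1)$, and $\psi(\xi,0)\ne0$. -/

import Mathlib

open Set Filter Topology MeasureTheory
open scoped ContDiff

/-- `ψ ∈ H¹₀((-1,1))` with weak derivative `ψ'`. The function `ψ` is the continuous representative
on `[-1,1]`, it vanishes at the end points, and `ψ' ∈ L²((-1,1))`. -/
structure IsH10 (ψ ψ' : ℝ → ℝ) : Prop where
  continuousOn : ContinuousOn ψ (Icc (-1) 1)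
  memLp_deriv : MemLp ψ' 2 (volume.restrict (Ioo (-1) 1))
  weak_deriv : ∀ φ : ℝ → ℝ, ContDiff ℝ ∞ φ → HasCompactSupport φ → tsupport φ ⊆ Ioo (-1) 1 →
    ∫ x in Ioo (-1 : ℝ) 1, ψ x * deriv φ x = -∫ x in Ioo (-1 : ℝ) 1, ψ' x * φ x
  left_eq_zero : ψ (-1) = 0
  right_eq_zero : ψ 1 = 0

/-- `ψ ∈ H²₀((-1,1))`, i.e. `ψ ∈ H²` and `ψ(±1) = ψ'(±1) = 0`, with first and second weak
derivatives `ψ'` (continuous representative) and `ψ''`. -/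
structure IsH20 (ψ ψ' ψ'' : ℝ → ℝ) : Prop where
  fst : IsH10 ψ ψ'
  snd : IsH10 ψ' ψ''

/-- The critical magnetic number: `|B|_c² = sup g[ρ]ψ(0)² / ∫ |ψ'|²` over nonzero `ψ ∈ H¹₀((-1,1))`,
where `[ρ] = ρp - ρm`. -/
noncomputable def criticalMagneticNumber (g ρp ρm : ℝ) : ℝ :=
  √(sSup {r : ℝ | ∃ ψ ψ' : ℝ → ℝ, IsH10 ψ ψ' ∧ 0 < ∫ x in Ioo (-1 : ℝ) 1, ψ' x ^ 2 ∧
    r = g * (ρp - ρm) * ψ 0 ^ 2 / ∫ x in Ioo (-1 : ℝ) 1, ψ' x ^ 2})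

/-- The critical frequency for the vertical magnetic field:
`(|ξ|_vc^B)² = inf |B|² ∫ |ψ''|² / (g[ρ]ψ(0)² - |B|² ∫ |ψ'|²)` over the `ψ ∈ H²₀((-1,1))`
for which the denominator is positive. -/
noncomputable def verticalCriticalFrequency (g ρp ρm B : ℝ) : ℝ :=
  √(sInf {r : ℝ | ∃ ψ ψ' ψ'' : ℝ → ℝ, IsH20 ψ ψ' ψ'' ∧
    0 < g * (ρp - ρm) * ψ 0 ^ 2 - |B| ^ 2 * ∫ x in Ioo (-1 : ℝ) 1, ψ' x ^ 2 ∧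
    r = (|B| ^ 2 * ∫ x in Ioo (-1 : ℝ) 1, ψ'' x ^ 2) /
      (g * (ρp - ρm) * ψ 0 ^ 2 - |B| ^ 2 * ∫ x in Ioo (-1 : ℝ) 1, ψ' x ^ 2)})

/-- The coefficient equal to `ap` in the upper fluid and to `am` in the lower fluid. -/
noncomputable def twoPhase (ap am : ℝ) (x : ℝ) : ℝ := if 0 < x then ap else am

/-- `f` has one-sided limits at `0`, and its jump `f(0+) - f(0-)` equals `j`. -/
def HasJump (f : ℝ → ℝ) (j : ℝ) : Prop :=
  ∃ fp fm : ℝ, Tendsto f (𝓝[>] 0) (𝓝 fp) ∧ Tendsto f (𝓝[<] 0) (𝓝 fm) ∧ fp - fm = j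

/-- `ψ` (on `[-1,1]`) and `lam` solve the fourth-order normal-mode problem at frequency `ξ`
for the vertical magnetic field of strength `B`, densities `ρp, ρm` and viscosities `μp, μm`
(upper, lower fluid). Only the values of `ψ` on `[-1,1]` matter. -/
structure IsNormalMode (g ρp ρm μp μm B ξ : ℝ) (ψ : ℝ → ℝ) (lam : ℝ) : Prop where
  contDiffOn_lower : ContDiffOn ℝ 4 ψ (Ioo (-1) 0)
  contDiffOn_upper : ContDiffOn ℝ 4 ψ (Ioo 0 1)
  ode : ∀ x ∈ Ioo (-1 : ℝ) 0 ∪ Ioo 0 1,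
    -(lam ^ 2 * twoPhase ρp ρm x * (|ξ| ^ 2 * ψ x - iteratedDeriv 2 ψ x)) =
      twoPhase μp μm x * lam *
        (|ξ| ^ 4 * ψ x - 2 * |ξ| ^ 2 * iteratedDeriv 2 ψ x + iteratedDeriv 4 ψ x) +
      |B| ^ 2 * (-(|ξ| ^ 2 * iteratedDeriv 2 ψ x) + iteratedDeriv 4 ψ x)
  /-- `⟦ψ⟧ = 0`, with the common trace being the value `ψ 0`. -/
  continuousAt_zero : ContinuousAt ψ 0
  jump_deriv : HasJump (deriv ψ) 0
  jump_second : HasJump (fun x =>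
    twoPhase μp μm x * lam * (|ξ| ^ 2 * ψ x + iteratedDeriv 2 ψ x) +
      |B| ^ 2 * iteratedDeriv 2 ψ x) 0
  jump_third : ∃ j : ℝ, HasJump (fun x => lam ^ 2 * twoPhase ρp ρm x * deriv ψ x) j ∧
    HasJump (fun x =>
      twoPhase μp μm x * lam * (iteratedDeriv 3 ψ x - 3 * |ξ| ^ 2 * deriv ψ x) +
        |B| ^ 2 * iteratedDeriv 3 ψ x) (j + g * (ρp - ρm) * |ξ| ^ 2 * ψ 0)
  left_eq_zero : ψ (-1) = 0
  right_eq_zero : ψ 1 = 0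
  left_tendsto : Tendsto ψ (𝓝[>] (-1)) (𝓝 0)
  right_tendsto : Tendsto ψ (𝓝[<] 1) (𝓝 0)
  left_deriv_tendsto : Tendsto (deriv ψ) (𝓝[>] (-1)) (𝓝 0)
  right_deriv_tendsto : Tendsto (deriv ψ) (𝓝[<] 1) (𝓝 0)

/-!
A normal mode of growth rate `λ` is a critical point: with `E(λ) = λ² K + λ V + B² M` the sum of
the inertial, viscous and magnetic energies on `H²₀((-1,1))`, the equation and the jump conditions
say that `E(λ)(ψ, φ) = g[ρ]ξ² ψ(0) φ(0)` for all `φ`.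

Testing with `φ = ψ`, there is no mode once `g[ρ]ξ² ψ(0)² ≤ B² M(ψ, ψ)` on `H²₀`, which is what
`|B|_c ≤ |B|` or `|ξ| ≤ |ξ|_vc^B` gives. Otherwise solve, for every `t > 0`, the problem with unit
load, `E(t)(u_t, φ) = φ(0)`. In each fluid it is an ODE with constant coefficients, so this is
linear algebra on the jets at the interface, where uniqueness, which the energy provides, implies
existence. The compliance `m(t) = u_t(0)` is nonincreasing and `t² m(t)` is nondecreasing, hence
`m` is continuous. It decays as `t → ∞`, and `g[ρ]ξ² m(t) ≥ 1` for small `t` if some `φ` has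
`B² M(φ, φ) < g[ρ]ξ² φ(0)²`. So `g[ρ]ξ² m(λ) = 1` for some `λ > 0`, and then `u_λ` is a mode.
-/

theorem hasCompactSupport_of_tsupport_subset_Ioo {k : ℝ → ℝ} {a b : ℝ}
    (hk : tsupport k ⊆ Ioo a b) : HasCompactSupport k :=
  isCompact_Icc.of_isClosed_subset (isClosed_tsupport k) (hk.trans Ioo_subset_Icc_self)

theorem intervalIntegral_eq_integral_of_tsupport_subset_Ioo {k : ℝ → ℝ} {a b : ℝ}
    (hk : tsupport k ⊆ Ioo a b) : ∫ x in a..b, k x = ∫ x, k x :=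
  intervalIntegral.integral_eq_integral_of_support_subset
    ((subset_tsupport k).trans (hk.trans Ioo_subset_Ioc_self))

theorem setIntegral_Ioo_eq_intervalIntegral {a b : ℝ} (hab : a ≤ b) (f : ℝ → ℝ) :
    ∫ x in Ioo a b, f x = ∫ x in a..b, f x := by
  rw [intervalIntegral.integral_of_le hab, integral_Ioc_eq_integral_Ioo]

theorem exists_subset_Icc_subset_Ioo {K : Set ℝ} {a b : ℝ} (hK : IsCompact K)
    (hsub : K ⊆ Ioo a b) : ∃ c d, K ⊆ Icc c d ∧ Icc c d ⊆ Ioo a b := by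
  rcases K.eq_empty_or_nonempty with rfl | hne
  · exact ⟨1, 0, empty_subset _, by simp⟩
  · obtain ⟨c, hc, hc'⟩ := hK.exists_isLeast hne
    obtain ⟨d, hd, hd'⟩ := hK.exists_isGreatest hne
    exact ⟨c, d, fun x hx => ⟨hc' hx, hd' hx⟩, Icc_subset_Ioo (hsub hc).1 (hsub hd).2⟩

theorem tsupport_integral_subset_Icc {k : ℝ → ℝ} {a b c d : ℝ} (hk : tsupport k ⊆ Icc c d)
    (hcd : Icc c d ⊆ Ioo a b) (h0 : ∫ x, k x = 0) :
    tsupport (fun x => ∫ t in a..x, k t) ⊆ Icc c d := by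
  have hzero : ∀ x, x ∉ Icc c d → k x = 0 := fun x hx =>
    image_eq_zero_of_notMem_tsupport fun h => hx (hk h)
  refine closure_minimal (fun x => ?_) isClosed_Icc
  contrapose!
  intro hx
  rcases le_or_gt c d with hle | hlt
  · have hac : a < c := (hcd (left_mem_Icc.2 hle)).1
    rcases lt_or_ge x c with hxc | hcx
    · refine Function.notMem_support.2 ((intervalIntegral.integral_congr (g := fun _ => (0 : ℝ))
        fun t ht => hzero t fun h => ?_).trans intervalIntegral.integral_zero)
      exact (ht.2.trans_lt (max_lt hac hxc)).not_ge h.1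
    · have hdx : d < x := lt_of_not_ge fun h => hx ⟨hcx, h⟩
      exact Function.notMem_support.2 ((intervalIntegral_eq_integral_of_tsupport_subset_Ioo
        (hk.trans (Icc_subset_Ioo hac hdx))).trans h0)
  · refine Function.notMem_support.2 ((intervalIntegral.integral_congr (g := fun _ => (0 : ℝ))
      fun t _ => hzero t ?_).trans intervalIntegral.integral_zero)
    simp [Icc_eq_empty_of_lt hlt]

theorem exists_deriv_eq_of_integral_eq_zero {k : ℝ → ℝ} {a b : ℝ} (hk : ContDiff ℝ ∞ k)
    (hks : tsupport k ⊆ Ioo a b) (h0 : ∫ x, k x = 0) :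
    ∃ φ : ℝ → ℝ, ContDiff ℝ ∞ φ ∧ tsupport φ ⊆ Ioo a b ∧ deriv φ = k := by
  obtain ⟨c, d, hkcd, hcd⟩ :=
    exists_subset_Icc_subset_Ioo (hasCompactSupport_of_tsupport_subset_Ioo hks) hks
  have hd : ∀ x, HasDerivAt (fun x => ∫ t in a..x, k t) (k x) x :=
    fun x => hk.continuous.integral_hasStrictDerivAt a x |>.hasDerivAt
  have hderiv : deriv (fun x => ∫ t in a..x, k t) = k := funext fun x => (hd x).deriv
  refine ⟨_, ?_, (tsupport_integral_subset_Icc hkcd hcd h0).trans hcd, hderiv⟩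
  rw [contDiff_infty_iff_deriv, hderiv]
  exact ⟨fun x => (hd x).differentiableAt, hk⟩

theorem exists_contDiff_tsupport_subset_Ioo_integral_eq_one {a b : ℝ} (hab : a < b) :
    ∃ θ : ℝ → ℝ, ContDiff ℝ ∞ θ ∧ tsupport θ ⊆ Ioo a b ∧ ∫ x, θ x = 1 := by
  let bump : ContDiffBump ((a + b) / 2) :=
    ⟨(b - a) / 4, (b - a) / 3, by linarith, by linarith⟩
  refine ⟨bump.normed volume, bump.contDiff_normed, ?_, bump.integral_normed⟩
  rw [bump.tsupport_normed_eq, Real.closedBall_eq_Icc]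
  exact Icc_subset_Ioo (show _ < (a + b) / 2 - (b - a) / 3 by linarith)
    (show (a + b) / 2 + (b - a) / 3 < _ by linarith)

/-- Du Bois-Reymond. -/
theorem exists_ae_eq_const_of_integral_mul_deriv_eq_zero {h : ℝ → ℝ} {a b : ℝ} (hab : a < b)
    (hi : IntervalIntegrable h volume a b)
    (hw : ∀ φ : ℝ → ℝ, ContDiff ℝ ∞ φ → tsupport φ ⊆ Ioo a b →
      ∫ x in a..b, h x * deriv φ x = 0) :
    ∃ C : ℝ, ∀ᵐ x, x ∈ Ioo a b → h x = C := by
  obtain ⟨θ, hθ, hθs, hθ1⟩ := exists_contDiff_tsupport_subset_Ioo_integral_eq_one hab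
  have hmul : ∀ {k : ℝ → ℝ}, Continuous k →
      IntervalIntegrable (fun x => h x * k x) volume a b :=
    fun hk => hi.mul_continuousOn hk.continuousOn
  set C : ℝ := ∫ x in a..b, h x * θ x with hC
  have hloc : LocallyIntegrableOn (fun x => h x - C) (Ioo a b) :=
    (((intervalIntegrable_iff_integrableOn_Ioo_of_le hab.le).1 hi).sub
      (integrableOn_const (by simp))).locallyIntegrableOn
  suffices ∀ᵐ x, x ∈ Ioo a b → h x - C = 0 from
    ⟨C, this.mono fun x hx hx' => sub_eq_zero.1 (hx hx')⟩
  refine isOpen_Ioo.ae_eq_zero_of_integral_contDiff_smul_eq_zero hloc fun k hk _ hks => ?_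
  have hcont := hk.continuous
  have hks' : tsupport (fun x => k x - (∫ y, k y) * θ x) ⊆ Ioo a b :=
    (tsupport_sub _ _).trans (union_subset hks (tsupport_mul_subset_right.trans hθs))
  obtain ⟨φ, hφ, hφs, hφd⟩ := exists_deriv_eq_of_integral_eq_zero
    (hk.sub (contDiff_const.mul hθ)) hks' (by
      rw [integral_sub (hcont.integrable_of_hasCompactSupport
          (hasCompactSupport_of_tsupport_subset_Ioo hks))
        ((hθ.continuous.integrable_of_hasCompactSupport
          (hasCompactSupport_of_tsupport_subset_Ioo hθs)).const_mul _),
        integral_const_mul, hθ1, mul_one, sub_self])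
  have hmean : ∫ x in a..b, h x * deriv φ x = (∫ x in a..b, h x * k x) - (∫ y, k y) * C := by
    rw [hC, ← intervalIntegral.integral_const_mul, ← intervalIntegral.integral_sub
      (hmul hcont) ((hmul hθ.continuous).const_mul _), hφd]
    exact intervalIntegral.integral_congr fun x _ => by ring
  calc ∫ x, k x • (h x - C)
    _ = ∫ x in a..b, k x • (h x - C) := (intervalIntegral_eq_integral_of_tsupport_subset_Ioo
        (tsupport_mul_subset_left.trans hks)).symm
    _ = ∫ x in a..b, (h x * k x - C * k x) :=
        intervalIntegral.integral_congr fun x _ => by simp only [smul_eq_mul]; ring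
    _ = (∫ x in a..b, h x * k x) - (∫ y, k y) * C := by
        rw [intervalIntegral.integral_sub (hmul hcont)
            ((hcont.intervalIntegrable _ _).const_mul C), intervalIntegral.integral_const_mul,
          intervalIntegral_eq_integral_of_tsupport_subset_Ioo hks, mul_comm C]
    _ = 0 := hmean ▸ hw φ hφ hφs

namespace IsH10

variable {f f' : ℝ → ℝ} {a b : ℝ}

theorem memLp (hf : IsH10 f f') : MemLp f 2 (volume.restrict (Ioo (-1) 1)) := by
  obtain ⟨C, hC⟩ := isCompact_Icc.exists_bound_of_continuousOn hf.continuousOn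
  exact MemLp.of_bound ((hf.continuousOn.mono Ioo_subset_Icc_self).aestronglyMeasurable
    measurableSet_Ioo) C
    ((ae_restrict_mem measurableSet_Ioo).mono fun x hx => hC x (Ioo_subset_Icc_self hx))

theorem intervalIntegrable_deriv_of_le (hf : IsH10 f f') (ha : -1 ≤ a) (hab : a ≤ b)
    (hb : b ≤ 1) : IntervalIntegrable f' volume a b := by
  rw [intervalIntegrable_iff_integrableOn_Ioo_of_le hab]
  exact (hf.memLp_deriv.integrable (by norm_num)).mono_measure
    (Measure.restrict_mono (Ioo_subset_Ioo ha hb) le_rfl)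

theorem intervalIntegrable_deriv (hf : IsH10 f f') : IntervalIntegrable f' volume (-1) 1 :=
  hf.intervalIntegrable_deriv_of_le le_rfl (by norm_num) le_rfl

theorem absolutelyContinuous_primitive (hf : IsH10 f f') :
    AbsolutelyContinuousOnInterval (fun x => ∫ t in (-1 : ℝ)..x, f' t) (-1) 1 :=
  hf.intervalIntegrable_deriv.absolutelyContinuousOnInterval_intervalIntegral (by simp)

theorem ae_deriv_primitive (hf : IsH10 f f') : ∀ᵐ x, x ∈ Icc (-1 : ℝ) 1 →
    deriv (fun x => ∫ t in (-1 : ℝ)..x, f' t) x = f' x := by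
  filter_upwards [hf.intervalIntegrable_deriv.ae_hasDerivAt_integral] with x hx hx'
  rw [uIcc_of_le (by norm_num)] at hx
  exact (hx hx' (-1) (by norm_num)).deriv

theorem integral_primitive_mul_deriv (hf : IsH10 f f') {φ : ℝ → ℝ} (hφ : ContDiff ℝ ∞ φ)
    (hφs : tsupport φ ⊆ Ioo (-1) 1) :
    ∫ x in (-1 : ℝ)..1, (∫ t in (-1 : ℝ)..x, f' t) * deriv φ x =
      -∫ x in (-1 : ℝ)..1, f' x * φ x := by
  have hφac : AbsolutelyContinuousOnInterval φ (-1) 1 :=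
    (hφ.of_le (by exact_mod_cast le_top)).contDiffOn.absolutelyContinuousOnInterval
  have hright : φ 1 = 0 := image_eq_zero_of_notMem_tsupport fun h => by simpa using (hφs h).2
  have hleft : φ (-1) = 0 := image_eq_zero_of_notMem_tsupport fun h => by simpa using (hφs h).1
  rw [hf.absolutelyContinuous_primitive.integral_mul_deriv_eq_deriv_mul hφac, hright, hleft,
    mul_zero, mul_zero, sub_zero, zero_sub, neg_inj]
  refine intervalIntegral.integral_congr_ae ?_
  filter_upwards [hf.ae_deriv_primitive] with x hx hx'
  rw [uIoc_of_le (by norm_num)] at hx'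
  rw [hx (Ioc_subset_Icc_self hx')]

theorem eq_integral (hf : IsH10 f f') {x : ℝ} (hx : x ∈ Icc (-1 : ℝ) 1) :
    f x = ∫ t in (-1 : ℝ)..x, f' t := by
  set F : ℝ → ℝ := fun x => ∫ t in (-1 : ℝ)..x, f' t
  have huIcc : uIcc (-1 : ℝ) 1 = Icc (-1) 1 := uIcc_of_le (by norm_num)
  have hFc : ContinuousOn F (Icc (-1) 1) := huIcc ▸ hf.absolutelyContinuous_primitive.continuousOn
  have hint : ∀ {k : ℝ → ℝ}, ContinuousOn k (Icc (-1) 1) → IntervalIntegrable k volume (-1) 1 :=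
    fun hk => ContinuousOn.intervalIntegrable (huIcc ▸ hk)
  obtain ⟨C, hC⟩ := exists_ae_eq_const_of_integral_mul_deriv_eq_zero
    (h := fun x => f x - F x) (by norm_num) (hint (hf.continuousOn.sub hFc)) fun φ hφ hφs => by
      have hd : ContinuousOn (deriv φ) (Icc (-1) 1) :=
        (hφ.continuous_deriv (by simp)).continuousOn
      have hw := hf.weak_deriv φ hφ (hasCompactSupport_of_tsupport_subset_Ioo hφs) hφs
      rw [setIntegral_Ioo_eq_intervalIntegral (by norm_num),
        setIntegral_Ioo_eq_intervalIntegral (by norm_num)] at hw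
      have hsplit : ∫ x in (-1 : ℝ)..1, (f x - F x) * deriv φ x =
          (∫ x in (-1 : ℝ)..1, f x * deriv φ x) - ∫ x in (-1 : ℝ)..1, F x * deriv φ x := by
        simp only [sub_mul]
        exact intervalIntegral.integral_sub (hint (hf.continuousOn.mul hd)) (hint (hFc.mul hd))
      rw [hsplit, hw, hf.integral_primitive_mul_deriv hφ hφs, sub_self]
  have hconst : EqOn (fun x => f x - F x) (fun _ => C) (Icc (-1) 1) := by
    refine Measure.eqOn_Icc_of_ae_eq (μ := volume) (by norm_num) ?_ (hf.continuousOn.sub hFc)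
      continuousOn_const
    rwa [← restrict_Ioo_eq_restrict_Icc, EventuallyEq, ae_restrict_iff' measurableSet_Ioo]
  have hC0 : f (-1) - F (-1) = C := hconst (left_mem_Icc.2 (by norm_num))
  have hFleft : F (-1) = 0 := intervalIntegral.integral_same
  rw [hf.left_eq_zero, hFleft, sub_zero] at hC0
  exact sub_eq_zero.1 ((hconst hx).trans hC0.symm)

theorem integral_deriv_mul_add (hf : IsH10 f f') {w w' : ℝ → ℝ}
    (hw : ∀ x, HasDerivAt w (w' x) x) (hw' : Continuous w') (ha : -1 ≤ a) (hab : a ≤ b)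
    (hb : b ≤ 1) : ∫ x in a..b, (w' x * f x + w x * f' x) = w b * f b - w a * f a := by
  have hsub : Icc a b ⊆ Icc (-1 : ℝ) 1 := Icc_subset_Icc ha hb
  have hac : AbsolutelyContinuousOnInterval (fun x => ∫ t in (-1 : ℝ)..x, f' t) a b :=
    hf.absolutelyContinuous_primitive.mono (by
      rwa [uIcc_of_le hab, uIcc_of_le (by norm_num)])
  have hdw : deriv w = w' := funext fun x => (hw x).deriv
  have hwac : AbsolutelyContinuousOnInterval w a b :=
    (contDiff_one_iff_deriv.2 ⟨fun x => (hw x).differentiableAt,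
      hdw ▸ hw'⟩).contDiffOn.absolutelyContinuousOnInterval
  rw [hf.eq_integral (hsub (right_mem_Icc.2 hab)), hf.eq_integral (hsub (left_mem_Icc.2 hab)),
    ← hwac.integral_deriv_mul_eq_sub hac]
  refine intervalIntegral.integral_congr_ae ?_
  filter_upwards [hf.ae_deriv_primitive] with x hx hx'
  rw [uIoc_of_le hab] at hx'
  have hx1 := hsub (Ioc_subset_Icc_self hx')
  rw [hx hx1, hdw, hf.eq_integral hx1]

theorem intervalIntegrable_deriv_mul_add (hf : IsH10 f f') {w w' : ℝ → ℝ}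
    (hw : Continuous w) (hw' : Continuous w') (ha : -1 ≤ a) (hab : a ≤ b) (hb : b ≤ 1) :
    IntervalIntegrable (fun x => w' x * f x + w x * f' x) volume a b := by
  refine IntervalIntegrable.add (ContinuousOn.intervalIntegrable ?_)
    ((hf.intervalIntegrable_deriv_of_le ha hab hb).continuousOn_mul hw.continuousOn)
  rw [uIcc_of_le hab]
  exact hw'.continuousOn.mul (hf.continuousOn.mono (Icc_subset_Icc ha hb))

theorem integral_deriv (hf : IsH10 f f') (ha : -1 ≤ a) (hab : a ≤ b) (hb : b ≤ 1) :
    ∫ x in a..b, f' x = f b - f a := by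
  simpa using hf.integral_deriv_mul_add (w := fun _ => 1) (w' := fun _ => 0)
    (fun x => hasDerivAt_const x 1) continuous_const ha hab hb

theorem intervalIntegrable_deriv_sq (hf : IsH10 f f') (ha : -1 ≤ a) (hab : a ≤ b) (hb : b ≤ 1) :
    IntervalIntegrable (fun x => f' x ^ 2) volume a b := by
  rw [intervalIntegrable_iff_integrableOn_Ioo_of_le hab]
  exact hf.memLp_deriv.integrable_sq.mono_measure
    (Measure.restrict_mono (Ioo_subset_Ioo ha hb) le_rfl)

theorem two_mul_slope_mul_sub_le (hf : IsH10 f f') (ha : -1 ≤ a) (hab : a ≤ b) (hb : b ≤ 1)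
    (c : ℝ) : 2 * c * (f b - f a) - c ^ 2 * (b - a) ≤ ∫ x in a..b, f' x ^ 2 := by
  have hi := hf.intervalIntegrable_deriv_of_le ha hab hb
  have hnonneg : 0 ≤ ∫ x in a..b, (f' x ^ 2 - (2 * c * f' x - c ^ 2)) :=
    intervalIntegral.integral_nonneg hab fun x _ => by nlinarith [sq_nonneg (f' x - c)]
  rw [intervalIntegral.integral_sub (hf.intervalIntegrable_deriv_sq ha hab hb)
      ((hi.const_mul _).sub intervalIntegrable_const),
    intervalIntegral.integral_sub (hi.const_mul _) intervalIntegrable_const,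
    intervalIntegral.integral_const_mul, hf.integral_deriv ha hab hb,
    intervalIntegral.integral_const, smul_eq_mul] at hnonneg
  linarith

/-- The constant `2` is attained by the tent function `1 - |x|`. -/
theorem two_mul_sq_le (hf : IsH10 f f') : 2 * f 0 ^ 2 ≤ ∫ x in Ioo (-1 : ℝ) 1, f' x ^ 2 := by
  have hl := hf.two_mul_slope_mul_sub_le le_rfl (b := 0) (by norm_num) (by norm_num) (f 0)
  have hr := hf.two_mul_slope_mul_sub_le (a := 0) (by norm_num) (by norm_num) le_rfl (-f 0)
  rw [hf.left_eq_zero] at hl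
  rw [hf.right_eq_zero] at hr
  rw [setIntegral_Ioo_eq_intervalIntegral (by norm_num),
    ← intervalIntegral.integral_add_adjacent_intervals
      (hf.intervalIntegrable_deriv_sq le_rfl (b := 0) (by norm_num) (by norm_num))
      (hf.intervalIntegrable_deriv_sq (by norm_num) (by norm_num) le_rfl)]
  nlinarith

theorem eq_zero_of_integral_sq_nonpos (hf : IsH10 f f')
    (h : ∫ x in Ioo (-1 : ℝ) 1, f' x ^ 2 ≤ 0) {x : ℝ} (hx : x ∈ Icc (-1 : ℝ) 1) : f x = 0 := by
  have h0 := h.antisymm (integral_nonneg fun x => sq_nonneg _)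
  rw [integral_eq_zero_iff_of_nonneg (fun x => sq_nonneg _) hf.memLp_deriv.integrable_sq,
    EventuallyEq, restrict_Ioo_eq_restrict_Ioc, ae_restrict_iff' measurableSet_Ioc] at h0
  rw [hf.eq_integral hx]
  refine intervalIntegral.integral_zero_ae ?_
  filter_upwards [h0] with t ht ht'
  rw [uIoc_of_le hx.1] at ht'
  exact eq_zero_of_pow_eq_zero (ht ⟨ht'.1, ht'.2.trans hx.2⟩)

theorem of_hasDerivAt_off_countable {s : Set ℝ} (hs : s.Countable)
    (hc : ContinuousOn f (Icc (-1) 1)) (hd : ∀ x ∈ Ioo (-1 : ℝ) 1 \ s, HasDerivAt f (f' x) x)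
    (hm : MemLp f' 2 (volume.restrict (Ioo (-1) 1))) (hl : f (-1) = 0) (hr : f 1 = 0) :
    IsH10 f f' where
  continuousOn := hc
  memLp_deriv := hm
  left_eq_zero := hl
  right_eq_zero := hr
  weak_deriv φ hφ _ _ := by
    have hi' : IntervalIntegrable f' volume (-1) 1 := by
      rw [intervalIntegrable_iff_integrableOn_Ioo_of_le (by norm_num)]
      exact hm.integrable (by norm_num)
    have hi₁ : IntervalIntegrable (fun x => f' x * φ x) volume (-1) 1 :=
      hi'.mul_continuousOn hφ.continuous.continuousOn
    have hi₂ : IntervalIntegrable (fun x => f x * deriv φ x) volume (-1) 1 :=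
      ContinuousOn.intervalIntegrable (by
        rw [uIcc_of_le (by norm_num)]
        exact hc.mul (hφ.continuous_deriv (by simp)).continuousOn)
    have h := integral_eq_of_hasDerivAt_off_countable_of_le (fun x => f x * φ x)
      (fun x => f' x * φ x + f x * deriv φ x) (show (-1 : ℝ) ≤ 1 by norm_num)
      hs (hc.mul hφ.continuous.continuousOn)
      (fun x hx => (hd x hx).mul ((hφ.differentiable (by simp)) x).hasDerivAt) (hi₁.add hi₂)
    rw [intervalIntegral.integral_add hi₁ hi₂, hl, hr] at h
    rw [setIntegral_Ioo_eq_intervalIntegral (by norm_num),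
      setIntegral_Ioo_eq_intervalIntegral (by norm_num)]
    linarith

end IsH10

section TwoPhase

variable {u v : ℝ → ℝ} {x : ℝ}

theorem twoPhase_of_pos (ap am : ℝ) (hx : 0 < x) : twoPhase ap am x = ap := if_pos hx

theorem twoPhase_of_nonpos (ap am : ℝ) (hx : x ≤ 0) : twoPhase ap am x = am := if_neg hx.not_gt

theorem twoPhase_eventuallyEq_of_pos (hx : 0 < x) :
    (fun y => twoPhase (u y) (v y) y) =ᶠ[𝓝 x] u :=
  (lt_mem_nhds hx).mono fun _ hy => twoPhase_of_pos _ _ hy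

theorem twoPhase_eventuallyEq_of_neg (hx : x < 0) :
    (fun y => twoPhase (u y) (v y) y) =ᶠ[𝓝 x] v :=
  (gt_mem_nhds hx).mono fun _ hy => twoPhase_of_nonpos _ _ hy.le

theorem continuous_twoPhase (hu : Continuous u) (hv : Continuous v) (h : u 0 = v 0) :
    Continuous fun y => twoPhase (u y) (v y) y :=
  (hv.if_le hu continuous_id continuous_const (by rintro x rfl; exact h.symm)).congr fun y => by
    rcases le_or_gt y 0 with hy | hy
    · rw [twoPhase_of_nonpos _ _ hy]; exact if_pos hy
    · rw [twoPhase_of_pos _ _ hy]; exact if_neg hy.not_ge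

theorem hasDerivAt_twoPhase {u' v' : ℝ → ℝ} (hu : HasDerivAt u (u' x) x)
    (hv : HasDerivAt v (v' x) x) (hx : x ≠ 0) :
    HasDerivAt (fun y => twoPhase (u y) (v y) y) (twoPhase (u' x) (v' x) x) x := by
  rcases lt_or_gt_of_ne hx with hneg | hpos
  · rw [twoPhase_of_nonpos _ _ hneg.le]
    exact hv.congr_of_eventuallyEq (twoPhase_eventuallyEq_of_neg hneg)
  · rw [twoPhase_of_pos _ _ hpos]
    exact hu.congr_of_eventuallyEq (twoPhase_eventuallyEq_of_pos hpos)

theorem memLp_restrict_Ioo_of_continuous {p : ENNReal} {a b : ℝ} (hu : Continuous u) :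
    MemLp u p (volume.restrict (Ioo a b)) := by
  obtain ⟨C, hC⟩ := (isCompact_Icc (a := a) (b := b)).exists_bound_of_continuousOn hu.continuousOn
  exact MemLp.of_bound hu.aestronglyMeasurable C
    ((ae_restrict_mem measurableSet_Ioo).mono fun x hx => hC x (Ioo_subset_Icc_self hx))

theorem memLp_twoPhase {p : ENNReal} {a b : ℝ} (hu : Continuous u) (hv : Continuous v) :
    MemLp (fun y => twoPhase (u y) (v y) y) p (volume.restrict (Ioo a b)) := by
  classical
  refine (MemLp.piecewise (s := Ioi 0) measurableSet_Ioi
    ((memLp_restrict_Ioo_of_continuous hu).mono_measure Measure.restrict_le_self)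
    ((memLp_restrict_Ioo_of_continuous hv).mono_measure Measure.restrict_le_self)).ae_eq
    (Eventually.of_forall fun y => ?_)
  by_cases hy : 0 < y <;> simp [twoPhase, hy]

theorem isH10_twoPhase (hu : ContDiff ℝ 1 u) (hv : ContDiff ℝ 1 v) (h0 : u 0 = v 0)
    (h1 : u 1 = 0) (hm1 : v (-1) = 0) :
    IsH10 (fun y => twoPhase (u y) (v y) y) (fun y => twoPhase (deriv u y) (deriv v y) y) :=
  .of_hasDerivAt_off_countable (countable_singleton 0)
    (continuous_twoPhase hu.continuous hv.continuous h0).continuousOn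
    (fun y hy => hasDerivAt_twoPhase (hu.differentiable one_ne_zero y).hasDerivAt
      (hv.differentiable one_ne_zero y).hasDerivAt hy.2)
    (memLp_twoPhase (hu.continuous_deriv le_rfl) (hv.continuous_deriv le_rfl))
    (by rw [twoPhase_of_nonpos _ _ (by norm_num), hm1]) (by rw [twoPhase_of_pos _ _ one_pos, h1])

end TwoPhase

/-- An element of `H²₀((-1,1))` together with its weak derivatives: `jet x i` is the value at `x`
of the `i`-th one. -/
structure H20 where
  jet : ℝ → Fin 3 → ℝ
  isH20 : IsH20 (jet · 0) (jet · 1) (jet · 2)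

namespace H20

theorem memLp (a : H20) (i : Fin 3) : MemLp (a.jet · i) 2 (volume.restrict (Ioo (-1) 1)) := by
  fin_cases i
  · exact a.isH20.fst.memLp
  · exact a.isH20.snd.memLp
  · exact a.isH20.snd.memLp_deriv

/-- The element of `H²₀((-1,1))` equal to `u` above and to `v` below the interface, for profiles
that match there to first order. -/
noncomputable def glue (u v : ℝ → ℝ) (hu : ContDiff ℝ 2 u) (hv : ContDiff ℝ 2 v)
    (h0 : ∀ i < 2, iteratedDeriv i u 0 = iteratedDeriv i v 0)
    (h1 : ∀ i < 2, iteratedDeriv i u 1 = 0) (hm1 : ∀ i < 2, iteratedDeriv i v (-1) = 0) :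
    H20 where
  jet x i := twoPhase (iteratedDeriv i u x) (iteratedDeriv i v x) x
  isH20 := by
    have hH10 : ∀ i < 2, IsH10 (fun x => twoPhase (iteratedDeriv i u x) (iteratedDeriv i v x) x)
        (fun x => twoPhase (iteratedDeriv (i + 1) u x) (iteratedDeriv (i + 1) v x) x) := by
      intro i hi
      have hle : (1 : WithTop ℕ∞) + i ≤ 2 := by exact_mod_cast (by omega : 1 + i ≤ 2)
      have hC1 : ∀ {w : ℝ → ℝ}, ContDiff ℝ 2 w → ContDiff ℝ 1 (iteratedDeriv i w) := by
        intro w hw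
        rw [iteratedDeriv_eq_iterate]
        exact (hw.of_le hle).iterate_deriv' 1 i
      simp only [iteratedDeriv_succ]
      exact isH10_twoPhase (hC1 hu) (hC1 hv) (h0 i hi) (h1 i hi) (hm1 i hi)
    exact ⟨hH10 0 two_pos, hH10 1 one_lt_two⟩

end H20

/-- The vector of the derivatives of `u` at `x` of order less than `n`. -/
noncomputable def derivJet {n : ℕ} (u : ℝ → ℝ) (x : ℝ) : Fin n → ℝ := fun k => iteratedDeriv k u x

section LinearODE

variable {n : ℕ} (c y : Fin (n + 1) → ℝ)

/-- The operator `A` for which the equation `u⁽ⁿ⁺¹⁾ = ∑ k, c k * u⁽ᵏ⁾` becomes `Y' = A Y` for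
`Y = (u, u', …, u⁽ⁿ⁾)`. -/
noncomputable def companion : (Fin (n + 1) → ℝ) →L[ℝ] (Fin (n + 1) → ℝ) :=
  ContinuousLinearMap.pi (Fin.lastCases (∑ k, c k • ContinuousLinearMap.proj k)
    fun i => ContinuousLinearMap.proj i.succ)

/-- The solution of `u⁽ⁿ⁺¹⁾ = ∑ k, c k * u⁽ᵏ⁾` with `u⁽ᵏ⁾(0) = y k` for `k ≤ n`. -/
noncomputable def linearODESolution (x : ℝ) : ℝ :=
  NormedSpace.exp (x • companion c) y 0

theorem companion_castSucc (i : Fin n) : companion c y i.castSucc = y i.succ := by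
  simp [companion]

theorem companion_last : companion c y (Fin.last n) = ∑ k, c k * y k := by
  simp [companion]

theorem hasDerivAt_exp_smul_companion_apply (k : Fin (n + 1)) (x : ℝ) :
    HasDerivAt (fun x : ℝ => NormedSpace.exp (x • companion c) y k)
      (companion c (NormedSpace.exp (x • companion c) y) k) x :=
  hasDerivAt_pi.1 ((hasDerivAt_exp_smul_const' (companion c) x).clm_apply
    (hasDerivAt_const x y) |>.congr_deriv (by simp)) k

theorem contDiff_linearODESolution : ContDiff ℝ ∞ (linearODESolution c y) := by
  have hexp : ContDiff ℝ ∞ fun x : ℝ => NormedSpace.exp (x • companion c) :=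
    (contDiff_iff_contDiffAt.2 fun A => (NormedSpace.exp_analytic (𝕂 := ℝ) A).contDiffAt).comp
      (contDiff_id.smul contDiff_const)
  exact contDiff_pi.1 (hexp.clm_apply contDiff_const) 0

theorem iteratedDeriv_linearODESolution (k : Fin (n + 1)) :
    iteratedDeriv k (linearODESolution c y) =
      fun x => NormedSpace.exp (x • companion c) y k := by
  induction k using Fin.induction with
  | zero => exact iteratedDeriv_zero
  | succ i ih =>
    rw [Fin.val_succ, iteratedDeriv_succ, ← Fin.val_castSucc i, ih]
    exact funext fun x => (hasDerivAt_exp_smul_companion_apply c y i.castSucc x).deriv.trans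
      (companion_castSucc c _ i)

theorem derivJet_linearODESolution (x : ℝ) :
    derivJet (linearODESolution c y) x = NormedSpace.exp (x • companion c) y :=
  funext fun k => congrFun (iteratedDeriv_linearODESolution c y k) x

theorem iteratedDeriv_succ_linearODESolution (x : ℝ) :
    iteratedDeriv (n + 1) (linearODESolution c y) x =
      ∑ k, c k * iteratedDeriv k (linearODESolution c y) x := by
  have hlast := iteratedDeriv_linearODESolution c y (Fin.last n)
  rw [Fin.val_last] at hlast
  rw [iteratedDeriv_succ, hlast,
    (hasDerivAt_exp_smul_companion_apply c y (Fin.last n) x).deriv, companion_last]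
  simp only [iteratedDeriv_linearODESolution]

theorem hasDerivAt_iteratedDeriv_of_contDiffOn {ψ : ℝ → ℝ} {s : Set ℝ} {m k : ℕ}
    (hs : IsOpen s) (hψ : ContDiffOn ℝ m ψ s) (hk : k < m) {x : ℝ} (hx : x ∈ s) :
    HasDerivAt (iteratedDeriv k ψ) (iteratedDeriv (k + 1) ψ x) x := by
  have hd : DifferentiableAt ℝ (iteratedDerivWithin k ψ s) x :=
    (hψ.differentiableOn_iteratedDerivWithin (by exact_mod_cast hk)
      hs.uniqueDiffOn).differentiableAt (hs.mem_nhds hx)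
  rw [iteratedDeriv_succ, hasDerivAt_deriv_iff]
  exact hd.congr_of_eventuallyEq ((iteratedDerivWithin_of_isOpen hs).symm.eventuallyEq_of_mem
    (hs.mem_nhds hx))

theorem hasDerivAt_derivJet_of_linearODE {ψ : ℝ → ℝ} {s : Set ℝ} (hs : IsOpen s)
    (hψ : ContDiffOn ℝ (n + 1 : ℕ) ψ s) {x : ℝ} (hx : x ∈ s)
    (hode : iteratedDeriv (n + 1) ψ x = ∑ k, c k * iteratedDeriv k ψ x) :
    HasDerivAt (derivJet ψ) (companion c (derivJet ψ x)) x := by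
  refine hasDerivAt_pi.2 fun k => ?_
  have hk := hasDerivAt_iteratedDeriv_of_contDiffOn hs hψ k.isLt hx
  induction k using Fin.lastCases with
  | last => exact hk.congr_deriv (hode.trans (companion_last c _).symm)
  | cast i => rwa [companion_castSucc]

theorem exists_eqOn_linearODESolution {ψ : ℝ → ℝ} {a b : ℝ}
    (hψ : ContDiffOn ℝ (n + 1 : ℕ) ψ (Ioo a b))
    (hode : ∀ x ∈ Ioo a b, iteratedDeriv (n + 1) ψ x = ∑ k, c k * iteratedDeriv k ψ x) :
    ∃ y, EqOn ψ (linearODESolution c y) (Ioo a b) := by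
  -- `exp (-x • A) (derivJet ψ x)` is a first integral of `Y' = A Y`.
  have hconst : ∀ x ∈ Ioo a b,
      HasDerivAt (fun x => NormedSpace.exp (x • -companion c) (derivJet ψ x)) 0 x := fun x hx =>
    ((hasDerivAt_exp_smul_const (-companion c) x).clm_apply
      (hasDerivAt_derivJet_of_linearODE c isOpen_Ioo hψ hx (hode x hx))).congr_deriv (by simp)
  obtain ⟨y, hy⟩ := isOpen_Ioo.exists_is_const_of_deriv_eq_zero isPreconnected_Ioo
    (fun x hx => (hconst x hx).differentiableAt.differentiableWithinAt)
    (fun x hx => (hconst x hx).deriv)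
  refine ⟨y, fun x hx => ?_⟩
  have hinv : NormedSpace.exp (x • companion c) * NormedSpace.exp (x • -companion c) = 1 := by
    let +nondep : NormedAlgebra ℚ ((Fin (n + 1) → ℝ) →L[ℝ] (Fin (n + 1) → ℝ)) :=
      .restrictScalars ℚ ℝ _
    rw [smul_neg, ← NormedSpace.exp_add_of_commute (Commute.refl (x • companion c)).neg_right,
      add_neg_cancel, NormedSpace.exp_zero]
  calc ψ x = derivJet (n := n + 1) ψ x 0 := (congrFun iteratedDeriv_zero x).symm
    _ = (NormedSpace.exp (x • companion c) * NormedSpace.exp (x • -companion c))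
          (derivJet ψ x) 0 := by
        rw [hinv]; rfl
    _ = linearODESolution c y x := by
        rw [linearODESolution, ← hy x hx]; rfl

end LinearODE

/-- The coefficients of the normal-mode equation
`-inertia * (ξ² u - u'') = viscosity * (ξ⁴ u - 2 ξ² u'' + u'''') + tension * (-ξ² u'' + u'''')`
in one fluid. -/
structure Medium where
  inertia : ℝ
  viscosity : ℝ
  tension : ℝ

namespace Medium

/-- The coefficients for a fluid of density `ρ` and viscosity `μ` in a magnetic field `B`, at
growth rate `t`. -/
def ofGrowthRate (ρ μ B t : ℝ) : Medium := ⟨t ^ 2 * ρ, t * μ, B ^ 2⟩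

/-- All coefficients are nonnegative. -/
structure Nonneg (m : Medium) : Prop where
  inertia : 0 ≤ m.inertia
  viscosity : 0 ≤ m.viscosity
  tension : 0 ≤ m.tension

theorem nonneg_ofGrowthRate {ρ μ t : ℝ} (hρ : 0 ≤ ρ) (hμ : 0 ≤ μ) (B : ℝ) (ht : 0 ≤ t) :
    (ofGrowthRate ρ μ B t).Nonneg :=
  ⟨by unfold ofGrowthRate; positivity, by unfold ofGrowthRate; positivity, sq_nonneg B⟩

theorem stiffness_ofGrowthRate_pos {ρ μ B t : ℝ} (hμ : 0 ≤ μ) (hB : 0 < μ + B ^ 2) (ht : 0 < t) :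
    0 < (ofGrowthRate ρ μ B t).viscosity + (ofGrowthRate ρ μ B t).tension := by
  rcases hμ.eq_or_lt with rfl | hμ
  · simpa [ofGrowthRate] using hB
  · unfold ofGrowthRate; positivity

/-- The symmetric form on second order jets whose Euler–Lagrange equation is the normal-mode
equation. -/
def density (m : Medium) (ξ : ℝ) (p q : Fin 3 → ℝ) : ℝ :=
  m.inertia * (ξ ^ 2 * (p 0 * q 0) + p 1 * q 1) +
    m.viscosity * ((ξ ^ 2 * p 0 + p 2) * (ξ ^ 2 * q 0 + q 2) + 4 * ξ ^ 2 * (p 1 * q 1)) +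
    m.tension * (ξ ^ 2 * (p 1 * q 1) + p 2 * q 2)

theorem density_self_nonneg {m : Medium} (hm : m.Nonneg) (ξ : ℝ) (p : Fin 3 → ℝ) :
    0 ≤ m.density ξ p p := by
  obtain ⟨hα, hβ, hγ⟩ := hm
  simp only [density, ← pow_two]
  positivity

theorem mul_sq_le_density_self {m : Medium} (hm : m.Nonneg) {c : ℝ} (hc : c ≤ m.inertia) (ξ : ℝ)
    (p : Fin 3 → ℝ) : c * p 1 ^ 2 ≤ m.density ξ p p := by
  have hrest := density_self_nonneg (m := ⟨0, m.viscosity, m.tension⟩)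
    ⟨le_rfl, hm.viscosity, hm.tension⟩ ξ p
  have h0 := mul_nonneg hm.inertia (mul_nonneg (sq_nonneg ξ) (sq_nonneg (p 0)))
  have h1 := mul_le_mul_of_nonneg_right hc (sq_nonneg (p 1))
  simp only [density] at hrest ⊢
  linarith

theorem density_quadratic (m : Medium) (ξ s : ℝ) (p q : Fin 3 → ℝ) :
    m.density ξ (s • p + q) (s • p + q) =
      m.density ξ p p * (s * s) + 2 * m.density ξ p q * s + m.density ξ q q := by
  simp only [density, Pi.add_apply, Pi.smul_apply, smul_eq_mul]
  ring

end Medium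

namespace H20

variable (a b : H20) (m mp mm : Medium) (ξ : ℝ)

theorem integrableOn_jet_mul_jet (i j : Fin 3) :
    IntegrableOn (fun x => a.jet x i * b.jet x j) (Ioo (-1) 1) :=
  (a.memLp i).integrable_mul (b.memLp j)

theorem integrableOn_jet_sq (i : Fin 3) : IntegrableOn (fun x => a.jet x i ^ 2) (Ioo (-1) 1) :=
  (a.memLp i).integrable_sq

theorem integrableOn_density :
    IntegrableOn (fun x => m.density ξ (a.jet x) (b.jet x)) (Ioo (-1) 1) := by
  have h00 := a.integrableOn_jet_mul_jet b 0 0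
  have h11 := a.integrableOn_jet_mul_jet b 1 1
  have h22 := a.integrableOn_jet_mul_jet b 2 2
  have hvisc : IntegrableOn
      (fun x => (ξ ^ 2 * a.jet x 0 + a.jet x 2) * (ξ ^ 2 * b.jet x 0 + b.jet x 2)) (Ioo (-1) 1) :=
    (((a.memLp 0).const_mul (ξ ^ 2)).add (a.memLp 2)).integrable_mul
      (((b.memLp 0).const_mul (ξ ^ 2)).add (b.memLp 2))
  exact ((((h00.const_mul _).add h11).const_mul _).add
    ((hvisc.add (h11.const_mul _)).const_mul _)).add (((h11.const_mul _).add h22).const_mul _)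

theorem integrableOn_density_lower :
    IntegrableOn (fun x => m.density ξ (a.jet x) (b.jet x)) (Ioo (-1) 0) :=
  (a.integrableOn_density b m ξ).mono_set (Ioo_subset_Ioo_right zero_le_one)

theorem integrableOn_density_upper :
    IntegrableOn (fun x => m.density ξ (a.jet x) (b.jet x)) (Ioo 0 1) :=
  (a.integrableOn_density b m ξ).mono_set (Ioo_subset_Ioo_left (by norm_num))

/-- The energy form for the medium `mp` in the upper and `mm` in the lower half of `(-1,1)`. -/
noncomputable def energy : ℝ :=
  (∫ x in Ioo (-1 : ℝ) 0, mm.density ξ (a.jet x) (b.jet x)) +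
    ∫ x in Ioo (0 : ℝ) 1, mp.density ξ (a.jet x) (b.jet x)

theorem energy_self_nonneg {mp mm : Medium} (hp : mp.Nonneg) (hm : mm.Nonneg) :
    0 ≤ energy a a mp mm ξ :=
  add_nonneg (integral_nonneg fun _ => Medium.density_self_nonneg hm ξ _)
    (integral_nonneg fun _ => Medium.density_self_nonneg hp ξ _)

theorem setIntegral_density_quadratic_nonneg {m : Medium} (hm : m.Nonneg) {S : Set ℝ}
    (hS : S ⊆ Ioo (-1) 1) (s : ℝ) :
    0 ≤ (∫ x in S, m.density ξ (a.jet x) (a.jet x)) * (s * s) +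
      2 * (∫ x in S, m.density ξ (a.jet x) (b.jet x)) * s +
      ∫ x in S, m.density ξ (b.jet x) (b.jet x) := by
  have haa := (a.integrableOn_density a m ξ).mono_set hS
  have hab := (a.integrableOn_density b m ξ).mono_set hS
  have hbb := (b.integrableOn_density b m ξ).mono_set hS
  rw [← integral_const_mul, ← integral_mul_const, ← integral_mul_const,
    ← integral_add (haa.mul_const _) ((hab.const_mul 2).mul_const s),
    ← integral_add ((haa.mul_const _).fun_add ((hab.const_mul 2).mul_const s)) hbb]
  exact integral_nonneg fun x =>
    (Medium.density_self_nonneg hm ξ _).trans_eq (Medium.density_quadratic m ξ s _ _)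

theorem energy_sq_le_mul {mp mm : Medium} (hp : mp.Nonneg) (hm : mm.Nonneg) :
    energy a b mp mm ξ ^ 2 ≤ energy a a mp mm ξ * energy b b mp mm ξ := by
  have hdiscrim := discrim_le_zero (a := energy a a mp mm ξ) (b := 2 * energy a b mp mm ξ)
    (c := energy b b mp mm ξ) fun s => by
      have hlower := setIntegral_density_quadratic_nonneg a b ξ hm
        (Ioo_subset_Ioo_right (zero_le_one (α := ℝ))) s
      have hupper := setIntegral_density_quadratic_nonneg a b ξ hp
        (Ioo_subset_Ioo_left (show (-1 : ℝ) ≤ 0 by norm_num)) s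
      unfold energy
      linarith
  unfold discrim at hdiscrim
  linarith

theorem energy_ofGrowthRate (ρp ρm μp μm B t : ℝ) :
    energy a b (.ofGrowthRate ρp μp B t) (.ofGrowthRate ρm μm B t) ξ =
      t ^ 2 * energy a b ⟨ρp, 0, 0⟩ ⟨ρm, 0, 0⟩ ξ + t * energy a b ⟨0, μp, 0⟩ ⟨0, μm, 0⟩ ξ +
        B ^ 2 * energy a b ⟨0, 0, 1⟩ ⟨0, 0, 1⟩ ξ := by
  have hdensity : ∀ (ρ μ : ℝ) {S : Set ℝ}, S ⊆ Ioo (-1) 1 →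
      ∫ x in S, (Medium.ofGrowthRate ρ μ B t).density ξ (a.jet x) (b.jet x) =
        t ^ 2 * (∫ x in S, Medium.density ⟨ρ, 0, 0⟩ ξ (a.jet x) (b.jet x)) +
          t * (∫ x in S, Medium.density ⟨0, μ, 0⟩ ξ (a.jet x) (b.jet x)) +
          B ^ 2 * ∫ x in S, Medium.density ⟨0, 0, 1⟩ ξ (a.jet x) (b.jet x) := by
    intro ρ μ S hS
    have hi := fun m : Medium => (a.integrableOn_density b m ξ).mono_set hS
    rw [← integral_const_mul, ← integral_const_mul, ← integral_const_mul,
      ← integral_add ((hi _).const_mul _) ((hi _).const_mul _),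
      ← integral_add (((hi _).const_mul _).fun_add ((hi _).const_mul _)) ((hi _).const_mul _)]
    refine integral_congr_ae (Eventually.of_forall fun x => ?_)
    simp only [Medium.density, Medium.ofGrowthRate]
    ring
  simp only [energy, hdensity _ _ (Ioo_subset_Ioo_right (zero_le_one (α := ℝ))),
    hdensity _ _ (Ioo_subset_Ioo_left (show (-1 : ℝ) ≤ 0 by norm_num))]
  ring

theorem setIntegral_Ioo_split {f : ℝ → ℝ} (hf : IntegrableOn f (Ioo (-1) 1)) :
    ∫ x in Ioo (-1 : ℝ) 1, f x = (∫ x in Ioo (-1 : ℝ) 0, f x) + ∫ x in Ioo (0 : ℝ) 1, f x := by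
  have hi : IntervalIntegrable f volume (-1) 1 :=
    (intervalIntegrable_iff_integrableOn_Ioo_of_le (by norm_num)).2 hf
  have h0 : (0 : ℝ) ∈ uIcc (-1) 1 := by norm_num [mem_uIcc]
  rw [setIntegral_Ioo_eq_intervalIntegral (by norm_num),
    setIntegral_Ioo_eq_intervalIntegral (by norm_num),
    setIntegral_Ioo_eq_intervalIntegral (by norm_num)]
  exact (intervalIntegral.integral_add_adjacent_intervals
    (hi.mono_set (uIcc_subset_uIcc_left h0)) (hi.mono_set (uIcc_subset_uIcc_right h0))).symm

theorem energy_tension :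
    energy a a ⟨0, 0, 1⟩ ⟨0, 0, 1⟩ ξ =
      ξ ^ 2 * (∫ x in Ioo (-1 : ℝ) 1, a.jet x 1 ^ 2) + ∫ x in Ioo (-1 : ℝ) 1, a.jet x 2 ^ 2 := by
  rw [energy, ← setIntegral_Ioo_split (a.integrableOn_density a ⟨0, 0, 1⟩ ξ),
    ← integral_const_mul,
    ← integral_add ((a.integrableOn_jet_sq 1).const_mul _) (a.integrableOn_jet_sq 2)]
  refine integral_congr_ae (Eventually.of_forall fun x => ?_)
  simp only [Medium.density]
  ring

variable {mp mm} in
theorem mul_integral_sq_le_energy {c : ℝ} (hp : mp.Nonneg) (hm : mm.Nonneg)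
    (hcp : c ≤ mp.inertia) (hcm : c ≤ mm.inertia) :
    c * ∫ x in Ioo (-1 : ℝ) 1, a.jet x 1 ^ 2 ≤ energy a a mp mm ξ := by
  have hi : IntegrableOn (fun x => c * a.jet x 1 ^ 2) (Ioo (-1) 1) :=
    (a.integrableOn_jet_sq 1).const_mul c
  rw [← integral_const_mul, setIntegral_Ioo_split hi]
  exact add_le_add
    (integral_mono (hi.mono_set (Ioo_subset_Ioo_right zero_le_one))
      (a.integrableOn_density_lower a _ ξ) fun _ => Medium.mul_sq_le_density_self hm hcm ξ _)
    (integral_mono (hi.mono_set (Ioo_subset_Ioo_left (by norm_num)))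
      (a.integrableOn_density_upper a _ ξ) fun _ => Medium.mul_sq_le_density_self hp hcp ξ _)

variable {mp mm} in
theorem mul_sq_le_energy {c : ℝ} (hc : 0 ≤ c) (hp : mp.Nonneg) (hm : mm.Nonneg)
    (hcp : c ≤ mp.inertia) (hcm : c ≤ mm.inertia) :
    2 * c * a.jet 0 0 ^ 2 ≤ energy a a mp mm ξ :=
  le_trans (by linarith [mul_le_mul_of_nonneg_left a.isH20.fst.two_mul_sq_le hc])
    (a.mul_integral_sq_le_energy ξ hp hm hcp hcm)

variable {a mp mm ξ} in
theorem eq_zero_of_energy_nonpos (hp : mp.Nonneg) (hm : mm.Nonneg) (hp' : 0 < mp.inertia)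
    (hm' : 0 < mm.inertia) (h : energy a a mp mm ξ ≤ 0) {x : ℝ} (hx : x ∈ Icc (-1) 1) :
    a.jet x 0 = 0 := by
  have hle := a.mul_integral_sq_le_energy ξ hp hm (min_le_left _ _) (min_le_right _ _)
  exact a.isH20.fst.eq_zero_of_integral_sq_nonpos
    (nonpos_of_mul_nonpos_right (hle.trans h) (lt_min hp' hm')) hx

variable {a} in
theorem eq_zero_of_energy_ofGrowthRate_le {ξ ρp ρm μp μm B t : ℝ} (hρp : 0 < ρp) (hρm : 0 < ρm)
    (hμp : 0 ≤ μp) (hμm : 0 ≤ μm) (ht : 0 < t)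
    (h : energy a a (.ofGrowthRate ρp μp B t) (.ofGrowthRate ρm μm B t) ξ ≤
      B ^ 2 * energy a a ⟨0, 0, 1⟩ ⟨0, 0, 1⟩ ξ) {x : ℝ} (hx : x ∈ Icc (-1) 1) :
    a.jet x 0 = 0 := by
  rw [energy_ofGrowthRate] at h
  have hvisc := mul_nonneg ht.le (a.energy_self_nonneg ξ (mp := ⟨0, μp, 0⟩) (mm := ⟨0, μm, 0⟩)
    ⟨le_rfl, hμp, le_rfl⟩ ⟨le_rfl, hμm, le_rfl⟩)
  have hinertia : t ^ 2 * energy a a ⟨ρp, 0, 0⟩ ⟨ρm, 0, 0⟩ ξ ≤ 0 := by linarith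
  exact eq_zero_of_energy_nonpos ⟨hρp.le, le_rfl, le_rfl⟩ ⟨hρm.le, le_rfl, le_rfl⟩ hρp hρm
    (nonpos_of_mul_nonpos_right hinertia (pow_pos ht 2)) hx

end H20

theorem continuousOn_of_antitoneOn_of_monotoneOn_sq_mul {m : ℝ → ℝ}
    (hanti : AntitoneOn m (Ioi 0)) (hmono : MonotoneOn (fun t => t ^ 2 * m t) (Ioi 0)) :
    ContinuousOn m (Ioi 0) := by
  intro s hs
  have hs0 : 0 < s := hs
  refine ContinuousAt.continuousWithinAt ?_
  have hratio : Tendsto (fun t : ℝ => s ^ 2 * m s / t ^ 2) (𝓝 s) (𝓝 (m s)) := by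
    have hcont : ContinuousAt (fun t : ℝ => s ^ 2 * m s / t ^ 2) s := by
      fun_prop (disch := positivity)
    simpa only [mul_div_cancel_left₀ _ (pow_pos hs0 2).ne'] using hcont.tendsto
  have hmin := (tendsto_const_nhds (x := m s)).min hratio
  have hmax := (tendsto_const_nhds (x := m s)).max hratio
  rw [min_self] at hmin
  rw [max_self] at hmax
  refine tendsto_of_tendsto_of_tendsto_of_le_of_le' hmin hmax ?_ ?_
  · filter_upwards [lt_mem_nhds hs0] with t ht
    rcases le_total t s with h | h
    · exact min_le_of_left_le (hanti ht hs h)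
    · refine min_le_of_right_le ((div_le_iff₀ (by positivity)).2 ?_)
      simpa only [mul_comm] using hmono hs ht h
  · filter_upwards [lt_mem_nhds hs0] with t ht
    rcases le_total t s with h | h
    · refine le_max_of_le_right ((le_div_iff₀ (by positivity)).2 ?_)
      simpa only [mul_comm] using hmono ht hs h
    · exact le_max_of_le_left (hanti hs ht h)

/-- The quadratic pencil `t² K + t V + M` of inertial, viscous and magnetic energies. -/
def pencil {X : Type*} (K V M : X → ℝ) (t : ℝ) (a : X) : ℝ := t ^ 2 * K a + t * V a + M a

/-- `u t` is the response to the load `ℓ` for the energy `pencil K V M t`. Two consequences of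
`⟪u t, b⟫ = ℓ b` are recorded: its case `b = u t`, and its combination with the Cauchy–Schwarz
inequality. -/
structure IsResponse {X : Type*} (K V M ℓ : X → ℝ) (u : ℝ → X) : Prop where
  inertia_nonneg : ∀ a, 0 ≤ K a
  viscosity_nonneg : ∀ a, 0 ≤ V a
  tension_nonneg : ∀ a, 0 ≤ M a
  pencil_self : ∀ t > 0, pencil K V M t (u t) = ℓ (u t)
  sq_le : ∀ t > 0, ∀ b, ℓ b ^ 2 ≤ ℓ (u t) * pencil K V M t b

namespace IsResponse

variable {X : Type*} {K V M ℓ : X → ℝ} {u : ℝ → X} {s t : ℝ}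

theorem compliance_nonneg (h : IsResponse K V M ℓ u) (ht : 0 < t) : 0 ≤ ℓ (u t) := by
  rw [← h.pencil_self t ht, pencil]
  have := h.inertia_nonneg (u t)
  have := h.viscosity_nonneg (u t)
  have := h.tension_nonneg (u t)
  positivity

theorem pencil_mono (h : IsResponse K V M ℓ u) (hs : 0 ≤ s) (hst : s ≤ t) (a : X) :
    pencil K V M s a ≤ pencil K V M t a := by
  have := h.inertia_nonneg a
  have := h.viscosity_nonneg a
  unfold pencil
  gcongr

theorem sq_mul_pencil_le (h : IsResponse K V M ℓ u) (hs : 0 ≤ s) (hst : s ≤ t) (a : X) :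
    s ^ 2 * pencil K V M t a ≤ t ^ 2 * pencil K V M s a := by
  have hV : s * t * V a * s ≤ s * t * V a * t :=
    mul_le_mul_of_nonneg_left hst (mul_nonneg (mul_nonneg hs (hs.trans hst)) (h.viscosity_nonneg a))
  have hM : s ^ 2 * M a ≤ t ^ 2 * M a :=
    mul_le_mul_of_nonneg_right (pow_le_pow_left₀ hs hst 2) (h.tension_nonneg a)
  unfold pencil
  linarith

theorem antitoneOn_compliance (h : IsResponse K V M ℓ u) :
    AntitoneOn (fun t => ℓ (u t)) (Ioi 0) := by
  intro s hs t ht hst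
  change ℓ (u t) ≤ ℓ (u s)
  have hle : ℓ (u t) * ℓ (u t) ≤ ℓ (u s) * ℓ (u t) := calc
    ℓ (u t) * ℓ (u t) ≤ ℓ (u s) * pencil K V M s (u t) := by rw [← pow_two]; exact h.sq_le s hs _
    _ ≤ ℓ (u s) * pencil K V M t (u t) :=
      mul_le_mul_of_nonneg_left (h.pencil_mono (le_of_lt hs) hst _) (h.compliance_nonneg hs)
    _ = ℓ (u s) * ℓ (u t) := by rw [h.pencil_self t ht]
  rcases (h.compliance_nonneg ht).eq_or_lt with h0 | hpos
  · exact h0 ▸ h.compliance_nonneg hs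
  · exact le_of_mul_le_mul_right hle hpos

theorem monotoneOn_sq_mul_compliance (h : IsResponse K V M ℓ u) :
    MonotoneOn (fun t => t ^ 2 * ℓ (u t)) (Ioi 0) := by
  intro s hs t ht hst
  have hle : s ^ 2 * ℓ (u s) * ℓ (u s) ≤ t ^ 2 * ℓ (u t) * ℓ (u s) := calc
    s ^ 2 * ℓ (u s) * ℓ (u s) = s ^ 2 * ℓ (u s) ^ 2 := by ring
    _ ≤ s ^ 2 * (ℓ (u t) * pencil K V M t (u s)) :=
      mul_le_mul_of_nonneg_left (h.sq_le t ht _) (sq_nonneg s)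
    _ = ℓ (u t) * (s ^ 2 * pencil K V M t (u s)) := by ring
    _ ≤ ℓ (u t) * (t ^ 2 * pencil K V M s (u s)) :=
      mul_le_mul_of_nonneg_left (h.sq_mul_pencil_le (le_of_lt hs) hst _) (h.compliance_nonneg ht)
    _ = t ^ 2 * ℓ (u t) * ℓ (u s) := by rw [h.pencil_self s hs]; ring
  rcases (h.compliance_nonneg hs).eq_or_lt with h0 | hpos
  · simp only [← h0, mul_zero]
    exact mul_nonneg (sq_nonneg t) (h.compliance_nonneg ht)
  · exact le_of_mul_le_mul_right hle hpos

theorem exists_one_le_mul_compliance (h : IsResponse K V M ℓ u) {κ : ℝ} {φ : X}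
    (hφ : M φ < κ * ℓ φ ^ 2) : ∃ s > 0, 1 ≤ κ * ℓ (u s) := by
  have hlim : Tendsto (fun t => pencil K V M t φ) (𝓝[>] 0) (𝓝 (M φ)) := by
    have hcont : Continuous fun t => pencil K V M t φ := by unfold pencil; fun_prop
    simpa [pencil] using (hcont.tendsto 0).mono_left nhdsWithin_le_nhds
  obtain ⟨s, hlt, hs⟩ := ((hlim.eventually_lt_const hφ).and self_mem_nhdsWithin).exists
  have hs0 : 0 < s := hs
  have hℓ : 0 < ℓ φ ^ 2 := by
    refine lt_of_le_of_ne (sq_nonneg _) fun h0 => ?_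
    rw [← h0, mul_zero] at hφ
    exact hφ.not_ge (h.tension_nonneg φ)
  refine ⟨s, hs0, le_of_mul_le_mul_right ?_ hℓ⟩
  calc 1 * ℓ φ ^ 2 ≤ ℓ (u s) * pencil K V M s φ := by rw [one_mul]; exact h.sq_le s hs0 φ
    _ ≤ ℓ (u s) * (κ * ℓ φ ^ 2) := mul_le_mul_of_nonneg_left hlt.le (h.compliance_nonneg hs0)
    _ = κ * ℓ (u s) * ℓ φ ^ 2 := by ring

theorem mul_compliance_le_one (h : IsResponse K V M ℓ u) {c : ℝ}
    (hK : ∀ a, c * ℓ a ^ 2 ≤ K a) (ht : 0 < t) : c * t ^ 2 * ℓ (u t) ≤ 1 := by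
  have hle : c * t ^ 2 * ℓ (u t) * ℓ (u t) ≤ 1 * ℓ (u t) := by
    have hself := h.pencil_self t ht
    unfold pencil at hself
    linarith [mul_le_mul_of_nonneg_left (hK (u t)) (sq_nonneg t),
      mul_nonneg ht.le (h.viscosity_nonneg (u t)), h.tension_nonneg (u t)]
  rcases (h.compliance_nonneg ht).eq_or_lt with h0 | hpos
  · simp [← h0]
  · exact le_of_mul_le_mul_right hle hpos

theorem exists_mul_compliance_eq_one (h : IsResponse K V M ℓ u) {c : ℝ} (hc : 0 < c)
    (hK : ∀ a, c * ℓ a ^ 2 ≤ K a) {κ : ℝ} {φ : X} (hφ : M φ < κ * ℓ φ ^ 2) :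
    ∃ t > 0, κ * ℓ (u t) = 1 := by
  obtain ⟨s, hs, hone⟩ := h.exists_one_le_mul_compliance hφ
  obtain ⟨t, hst, ht⟩ : ∃ t, s ≤ t ∧ κ ≤ c * t ^ 2 :=
    ((eventually_ge_atTop s).and
      (((tendsto_pow_atTop two_ne_zero).const_mul_atTop hc).eventually_ge_atTop κ)).exists
  have ht0 : 0 < t := hs.trans_le hst
  have hle : κ * ℓ (u t) ≤ 1 :=
    (mul_le_mul_of_nonneg_right ht (h.compliance_nonneg ht0)).trans (h.mul_compliance_le_one hK ht0)
  have hcont : ContinuousOn (fun r => κ * ℓ (u r)) (Icc s t) :=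
    continuousOn_const.mul ((continuousOn_of_antitoneOn_of_monotoneOn_sq_mul
      h.antitoneOn_compliance h.monotoneOn_sq_mul_compliance).mono fun _ hr => hs.trans_le hr.1)
  obtain ⟨r, hr, heq⟩ := intermediate_value_Icc' hst hcont ⟨hle, hone⟩
  exact ⟨r, hs.trans_le hr.1, heq⟩

end IsResponse

theorem continuous_iteratedDeriv_of_smooth {u : ℝ → ℝ} (hu : ContDiff ℝ ∞ u) (k : ℕ) :
    Continuous (iteratedDeriv k u) :=
  hu.continuous_iteratedDeriv k (by exact_mod_cast le_top)

theorem hasDerivAt_iteratedDeriv_of_smooth {u : ℝ → ℝ} (hu : ContDiff ℝ ∞ u) (k : ℕ) (x : ℝ) :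
    HasDerivAt (iteratedDeriv k u) (iteratedDeriv (k + 1) u x) x := by
  rw [iteratedDeriv_succ]
  exact (hu.differentiable_iteratedDeriv k (by exact_mod_cast ENat.natCast_lt_top k) x).hasDerivAt

theorem eqOn_iteratedDeriv_zero_of_eqOn_Ioo {u : ℝ → ℝ} (hu : ContDiff ℝ ∞ u) {a b : ℝ}
    (hab : a < b) (h : EqOn u 0 (Ioo a b)) (k : ℕ) : EqOn (iteratedDeriv k u) 0 (Icc a b) := by
  rw [← closure_Ioo hab.ne]
  refine EqOn.closure (fun x hx => ?_) (continuous_iteratedDeriv_of_smooth hu k) continuous_zero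
  rw [h.iteratedDeriv_of_isOpen isOpen_Ioo k hx]
  simp [Pi.zero_def]

namespace Medium

variable (m : Medium) (ξ : ℝ)

/-- The normal-mode equation of one fluid at the point `x`. -/
def SolvesAt (u : ℝ → ℝ) (x : ℝ) : Prop :=
  -(m.inertia * (ξ ^ 2 * u x - iteratedDeriv 2 u x)) =
    m.viscosity * (ξ ^ 4 * u x - 2 * ξ ^ 2 * iteratedDeriv 2 u x + iteratedDeriv 4 u x) +
      m.tension * (-(ξ ^ 2 * iteratedDeriv 2 u x) + iteratedDeriv 4 u x)

/-- The boundary term conjugate to `φ'` in the integration by parts of the energy against `φ`,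
as a function of the jet of the solution. -/
def moment (y : Fin 4 → ℝ) : ℝ := m.viscosity * (ξ ^ 2 * y 0 + y 2) + m.tension * y 2

/-- The boundary term conjugate to `φ` in the integration by parts of the energy against `φ`,
as a function of the jet of the solution. -/
def shear (y : Fin 4 → ℝ) : ℝ :=
  (m.inertia + 3 * m.viscosity * ξ ^ 2 + m.tension * ξ ^ 2) * y 1 -
    (m.viscosity + m.tension) * y 3

theorem setIntegral_density_eq_boundary {u : ℝ → ℝ} (hu : ContDiff ℝ ∞ u) {a b : ℝ}
    (hode : ∀ x ∈ Ioo a b, m.SolvesAt ξ u x) (φ : H20) (ha : -1 ≤ a) (hab : a ≤ b)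
    (hb : b ≤ 1) :
    ∫ x in Ioo a b, m.density ξ (derivJet u x) (φ.jet x) =
      (m.moment ξ (derivJet u b) * φ.jet b 1 + m.shear ξ (derivJet u b) * φ.jet b 0) -
        (m.moment ξ (derivJet u a) * φ.jet a 1 + m.shear ξ (derivJet u a) * φ.jet a 0) := by
  have hd := hasDerivAt_iteratedDeriv_of_smooth hu
  have hc := continuous_iteratedDeriv_of_smooth hu
  set M' : ℝ → ℝ := fun x => m.viscosity * (ξ ^ 2 * iteratedDeriv 1 u x + iteratedDeriv 3 u x) +
    m.tension * iteratedDeriv 3 u x with hM'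
  set S' : ℝ → ℝ := fun x =>
    (m.inertia + 3 * m.viscosity * ξ ^ 2 + m.tension * ξ ^ 2) * iteratedDeriv 2 u x -
      (m.viscosity + m.tension) * iteratedDeriv 4 u x with hS'
  have hM : ∀ x, HasDerivAt (fun x => m.moment ξ (derivJet u x)) (M' x) x := fun x =>
    ((((hd 0 x).const_mul _).add (hd 2 x)).const_mul _).add ((hd 2 x).const_mul _)
  have hS : ∀ x, HasDerivAt (fun x => m.shear ξ (derivJet u x)) (S' x) x := fun x =>
    ((hd 1 x).const_mul _).sub ((hd 3 x).const_mul _)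
  have hM'c : Continuous M' := by fun_prop (disch := exact hc _)
  have hS'c : Continuous S' := by fun_prop (disch := exact hc _)
  have hMc := continuous_iff_continuousAt.2 fun x => (hM x).continuousAt
  have hSc := continuous_iff_continuousAt.2 fun x => (hS x).continuousAt
  have hdensity : EqOn (fun x => m.density ξ (derivJet u x) (φ.jet x)) (fun x =>
      (M' x * φ.jet x 1 + m.moment ξ (derivJet u x) * φ.jet x 2) +
        (S' x * φ.jet x 0 + m.shear ξ (derivJet u x) * φ.jet x 1)) (Ioo a b) := by
    intro x hx
    have h := hode x hx
    simp only [SolvesAt] at h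
    simp only [density, derivJet, moment, shear, hM', hS', Fin.val_zero, Fin.val_one, Fin.val_two,
      Fin.isValue, iteratedDeriv_zero, show ((3 : Fin 4) : ℕ) = 3 from rfl]
    linear_combination (-φ.jet x 0) * h
  rw [setIntegral_congr_fun measurableSet_Ioo hdensity, setIntegral_Ioo_eq_intervalIntegral hab,
    intervalIntegral.integral_add
      (φ.isH20.snd.intervalIntegrable_deriv_mul_add hMc hM'c ha hab hb)
      (φ.isH20.fst.intervalIntegrable_deriv_mul_add hSc hS'c ha hab hb),
    φ.isH20.snd.integral_deriv_mul_add hM hM'c ha hab hb,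
    φ.isH20.fst.integral_deriv_mul_add hS hS'c ha hab hb]
  ring

end Medium

/-- The normal-mode equations for the profiles `u` in the upper and `v` in the lower fluid, with the
boundary conditions and the jump conditions, where the gravitational term of the shear jump is
replaced by a prescribed load `τ`. -/
structure IsTransmission (mp mm : Medium) (ξ τ : ℝ) (u v : ℝ → ℝ) : Prop where
  contDiff_upper : ContDiff ℝ ∞ u
  contDiff_lower : ContDiff ℝ ∞ v
  ode_upper : ∀ x ∈ Ioo 0 1, mp.SolvesAt ξ u x
  ode_lower : ∀ x ∈ Ioo (-1) 0, mm.SolvesAt ξ v x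
  matching : ∀ i < 2, iteratedDeriv i u 0 = iteratedDeriv i v 0
  moment_eq : mp.moment ξ (derivJet u 0) = mm.moment ξ (derivJet v 0)
  shear_sub : mm.shear ξ (derivJet v 0) - mp.shear ξ (derivJet u 0) = τ
  right_eq_zero : ∀ i < 2, iteratedDeriv i u 1 = 0
  left_eq_zero : ∀ i < 2, iteratedDeriv i v (-1) = 0

namespace IsTransmission

variable {mp mm : Medium} {ξ τ : ℝ} {u v : ℝ → ℝ}

/-- The two profiles as a single element of `H²₀((-1,1))`. -/
noncomputable def toH20 (h : IsTransmission mp mm ξ τ u v) : H20 :=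
  .glue u v (h.contDiff_upper.of_le ENat.LEInfty.out)
    (h.contDiff_lower.of_le ENat.LEInfty.out) h.matching h.right_eq_zero h.left_eq_zero

theorem toH20_jet_of_pos (h : IsTransmission mp mm ξ τ u v) {x : ℝ} (hx : 0 < x) :
    h.toH20.jet x = derivJet u x :=
  funext fun _ => twoPhase_of_pos _ _ hx

theorem toH20_jet_of_nonpos (h : IsTransmission mp mm ξ τ u v) {x : ℝ} (hx : x ≤ 0) :
    h.toH20.jet x = derivJet v x :=
  funext fun _ => twoPhase_of_nonpos _ _ hx

theorem eqOn_upper (h : IsTransmission mp mm ξ τ u v) : EqOn (h.toH20.jet · 0) u (Ioi 0) :=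
  fun x hx => by simp [h.toH20_jet_of_pos hx, derivJet]

theorem eqOn_lower (h : IsTransmission mp mm ξ τ u v) : EqOn (h.toH20.jet · 0) v (Iic 0) :=
  fun x hx => by simp [h.toH20_jet_of_nonpos hx, derivJet]

theorem toH20_jet_zero (h : IsTransmission mp mm ξ τ u v) : h.toH20.jet 0 0 = u 0 :=
  (h.eqOn_lower self_mem_Iic).trans (h.matching 0 two_pos).symm

theorem energy_eq (h : IsTransmission mp mm ξ τ u v) (φ : H20) :
    h.toH20.energy φ mp mm ξ = τ * φ.jet 0 0 := by
  have hlower : ∫ x in Ioo (-1 : ℝ) 0, mm.density ξ (h.toH20.jet x) (φ.jet x) =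
      ∫ x in Ioo (-1 : ℝ) 0, mm.density ξ (derivJet v x) (φ.jet x) :=
    setIntegral_congr_fun measurableSet_Ioo fun x hx => by
      simp only [h.toH20_jet_of_nonpos hx.2.le]
  have hupper : ∫ x in Ioo (0 : ℝ) 1, mp.density ξ (h.toH20.jet x) (φ.jet x) =
      ∫ x in Ioo (0 : ℝ) 1, mp.density ξ (derivJet u x) (φ.jet x) :=
    setIntegral_congr_fun measurableSet_Ioo fun x hx => by
      simp only [h.toH20_jet_of_pos hx.1]
  rw [H20.energy, hlower, hupper,
    mm.setIntegral_density_eq_boundary ξ h.contDiff_lower h.ode_lower φ le_rfl (by norm_num)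
      zero_le_one,
    mp.setIntegral_density_eq_boundary ξ h.contDiff_upper h.ode_upper φ (by norm_num)
      zero_le_one le_rfl,
    φ.isH20.fst.left_eq_zero, φ.isH20.fst.right_eq_zero, φ.isH20.snd.left_eq_zero,
    φ.isH20.snd.right_eq_zero, h.moment_eq, ← h.shear_sub]
  ring

end IsTransmission

namespace IsTransmission

variable {mp mm : Medium} {ξ τ : ℝ} {u v : ℝ → ℝ}

theorem derivJet_zero_eq_zero (h : IsTransmission mp mm ξ τ u v)
    (h0 : ∀ x ∈ Icc (-1 : ℝ) 1, h.toH20.jet x 0 = 0) {n : ℕ} :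
    derivJet (n := n) u 0 = 0 ∧ derivJet (n := n) v 0 = 0 := by
  have hu : EqOn u 0 (Ioo 0 1) := fun x hx =>
    (h.eqOn_upper hx.1).symm.trans (h0 x ⟨by linarith [hx.1], hx.2.le⟩)
  have hv : EqOn v 0 (Ioo (-1) 0) := fun x hx =>
    (h.eqOn_lower hx.2.le).symm.trans (h0 x ⟨hx.1.le, by linarith [hx.2]⟩)
  exact ⟨funext fun k => eqOn_iteratedDeriv_zero_of_eqOn_Ioo h.contDiff_upper one_pos hu k
      (left_mem_Icc.2 zero_le_one),
    funext fun k => eqOn_iteratedDeriv_zero_of_eqOn_Ioo h.contDiff_lower (by norm_num) hv k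
      (right_mem_Icc.2 (by norm_num))⟩

end IsTransmission

namespace Medium

variable (m mp mm : Medium) (ξ : ℝ)

/-- The coefficients of the normal-mode equation solved for the fourth derivative. -/
noncomputable def odeCoeff : Fin 4 → ℝ :=
  ![-(m.viscosity * ξ ^ 4 + m.inertia * ξ ^ 2) / (m.viscosity + m.tension), 0,
    (m.inertia + 2 * m.viscosity * ξ ^ 2 + m.tension * ξ ^ 2) / (m.viscosity + m.tension), 0]

variable {m mp mm} in
theorem solvesAt_iff (hm : 0 < m.viscosity + m.tension) {u : ℝ → ℝ} {x : ℝ} :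
    m.SolvesAt ξ u x ↔ iteratedDeriv 4 u x = ∑ k, m.odeCoeff ξ k * iteratedDeriv k u x := by
  have hne := hm.ne'
  rw [← mul_right_inj' hne]
  simp only [SolvesAt, odeCoeff, Fin.sum_univ_four, Matrix.cons_val, Fin.isValue, Fin.val_zero,
    Fin.val_one, Fin.val_two, iteratedDeriv_zero, zero_mul, add_zero]
  field_simp
  constructor <;> intro h <;> linarith

/-- The boundary and interface data of the pair of solutions with the given jets at the interface:
the values and slopes at `1` and at `-1`, then the jumps of value and slope, of moment and of shear
across the interface. -/
noncomputable def interfaceMap : (Fin 4 → ℝ) × (Fin 4 → ℝ) →ₗ[ℝ]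
    (Fin 2 → ℝ) × (Fin 2 → ℝ) × (Fin 2 → ℝ) × ℝ × ℝ where
  toFun p :=
    (fun i => NormedSpace.exp ((1 : ℝ) • companion (mp.odeCoeff ξ)) p.1 (i.castLE (by simp)),
      fun i => NormedSpace.exp ((-1 : ℝ) • companion (mm.odeCoeff ξ)) p.2 (i.castLE (by simp)),
      fun i => p.1 (i.castLE (by simp)) - p.2 (i.castLE (by simp)),
      mp.moment ξ p.1 - mm.moment ξ p.2, mm.shear ξ p.2 - mp.shear ξ p.1)
  map_add' p q := by
    ext <;> simp [moment, shear] <;> ring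
  map_smul' r p := by
    ext <;> simp [moment, shear] <;> ring

variable {m mp mm ξ}

theorem isTransmission_of_interfaceMap_eq {τ : ℝ} (hp : 0 < mp.viscosity + mp.tension)
    (hm : 0 < mm.viscosity + mm.tension) {p : (Fin 4 → ℝ) × (Fin 4 → ℝ)}
    (h : interfaceMap mp mm ξ p = (0, 0, 0, 0, τ)) :
    IsTransmission mp mm ξ τ (linearODESolution (mp.odeCoeff ξ) p.1)
      (linearODESolution (mm.odeCoeff ξ) p.2) := by
  have hjet : ∀ (c y : Fin 4 → ℝ) (x : ℝ) (i : Fin 2), iteratedDeriv i (linearODESolution c y) x =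
      NormedSpace.exp (x • companion c) y (i.castLE (by simp)) := fun c y x i =>
    congrFun (derivJet_linearODESolution c y x) (i.castLE (by simp))
  simp only [interfaceMap, LinearMap.coe_mk, AddHom.coe_mk, Prod.mk.injEq, funext_iff] at h
  obtain ⟨hright, hleft, hmatch, hmoment, hshear⟩ := h
  refine ⟨contDiff_linearODESolution _ _, contDiff_linearODESolution _ _,
    fun x _ => (solvesAt_iff ξ hp).2 (iteratedDeriv_succ_linearODESolution _ _ x),
    fun x _ => (solvesAt_iff ξ hm).2 (iteratedDeriv_succ_linearODESolution _ _ x),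
    fun i hi => ?_, ?_, ?_, fun i hi => (hjet _ _ _ ⟨i, hi⟩).trans (hright ⟨i, hi⟩),
    fun i hi => (hjet _ _ _ ⟨i, hi⟩).trans (hleft ⟨i, hi⟩)⟩
  · simpa [hjet _ _ _ ⟨i, hi⟩, sub_eq_zero] using hmatch ⟨i, hi⟩
  · simpa [derivJet_linearODESolution, sub_eq_zero] using hmoment
  · simpa [derivJet_linearODESolution] using hshear

theorem interfaceMap_injective (hp : mp.Nonneg) (hm : mm.Nonneg) (hp0 : 0 < mp.inertia)
    (hm0 : 0 < mm.inertia) (hp1 : 0 < mp.viscosity + mp.tension)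
    (hm1 : 0 < mm.viscosity + mm.tension) : Function.Injective (interfaceMap mp mm ξ) := by
  refine (injective_iff_map_eq_zero _).2 fun p hp' => ?_
  have h := isTransmission_of_interfaceMap_eq hp1 hm1 hp'
  have henergy : h.toH20.energy h.toH20 mp mm ξ ≤ 0 := by rw [h.energy_eq, zero_mul]
  obtain ⟨hu, hv⟩ := h.derivJet_zero_eq_zero (n := 4) fun x =>
    H20.eq_zero_of_energy_nonpos hp hm hp0 hm0 henergy
  simpa [derivJet_linearODESolution, Prod.ext_iff] using And.intro hu hv

theorem exists_isTransmission (hp : mp.Nonneg) (hm : mm.Nonneg) (hp0 : 0 < mp.inertia)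
    (hm0 : 0 < mm.inertia) (hp1 : 0 < mp.viscosity + mp.tension)
    (hm1 : 0 < mm.viscosity + mm.tension) (ξ τ : ℝ) : ∃ u v, IsTransmission mp mm ξ τ u v := by
  obtain ⟨p, hp'⟩ := (LinearMap.injective_iff_surjective_of_finrank_eq_finrank (by simp)).1
    (interfaceMap_injective (ξ := ξ) hp hm hp0 hm0 hp1 hm1) (0, 0, 0, 0, τ)
  exact ⟨_, _, isTransmission_of_interfaceMap_eq hp1 hm1 hp'⟩

end Medium

section OneSided

variable {F G H : ℝ → ℝ} {a b l : ℝ}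

theorem tendsto_nhdsGT_iff_of_eqOn (hab : a < b) (hG : Continuous G) (h : EqOn F G (Ioo a b)) :
    Tendsto F (𝓝[>] a) (𝓝 l) ↔ G a = l := by
  have hlim : Tendsto G (𝓝[>] a) (𝓝 (G a)) := hG.continuousWithinAt
  rw [tendsto_congr' (h.eventuallyEq_of_mem (Ioo_mem_nhdsGT hab))]
  exact ⟨tendsto_nhds_unique hlim, fun hl => hl ▸ hlim⟩

theorem tendsto_nhdsLT_iff_of_eqOn (hab : a < b) (hG : Continuous G) (h : EqOn F G (Ioo a b)) :
    Tendsto F (𝓝[<] b) (𝓝 l) ↔ G b = l := by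
  have hlim : Tendsto G (𝓝[<] b) (𝓝 (G b)) := hG.continuousWithinAt
  rw [tendsto_congr' (h.eventuallyEq_of_mem (Ioo_mem_nhdsLT hab))]
  exact ⟨tendsto_nhds_unique hlim, fun hl => hl ▸ hlim⟩

theorem continuousAt_iff_of_eqOn {c : ℝ} (hac : a < c) (hcb : c < b) (hG : Continuous G)
    (hH : Continuous H) (hFG : EqOn F G (Ioo c b)) (hFH : EqOn F H (Ioo a c)) :
    ContinuousAt F c ↔ F c = G c ∧ F c = H c := by
  rw [continuousAt_iff_continuous_left'_right', ContinuousWithinAt, ContinuousWithinAt,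
    tendsto_nhdsGT_iff_of_eqOn hcb hG hFG, tendsto_nhdsLT_iff_of_eqOn hac hH hFH]
  tauto

theorem hasJump_iff_of_eqOn (ha : a < 0) (hb : 0 < b) (hG : Continuous G) (hH : Continuous H)
    (hFG : EqOn F G (Ioo 0 b)) (hFH : EqOn F H (Ioo a 0)) : HasJump F l ↔ G 0 - H 0 = l := by
  simp [HasJump, tendsto_nhdsGT_iff_of_eqOn hb hG hFG, tendsto_nhdsLT_iff_of_eqOn ha hH hFH]

end OneSided

section NormalMode

variable {ψ u v : ℝ → ℝ}

theorem hasJump_iff_derivJet {n : ℕ} {F : ℝ → ℝ} {Lp Lm : (Fin n → ℝ) → ℝ} {j : ℝ}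
    (hu : ContDiff ℝ ∞ u) (hv : ContDiff ℝ ∞ v) (hψu : EqOn ψ u (Ioo 0 1))
    (hψv : EqOn ψ v (Ioo (-1) 0)) (hLp : Continuous Lp) (hLm : Continuous Lm)
    (hFp : ∀ x > 0, F x = Lp (derivJet ψ x)) (hFm : ∀ x < 0, F x = Lm (derivJet ψ x)) :
    HasJump F j ↔ Lp (derivJet u 0) - Lm (derivJet v 0) = j := by
  have hjet : ∀ {w : ℝ → ℝ} {s : Set ℝ}, IsOpen s → EqOn ψ w s →
      EqOn (derivJet (n := n) ψ) (derivJet w) s := fun hs h x hx =>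
    funext fun k => h.iteratedDeriv_of_isOpen hs k hx
  have hcont : ∀ {w : ℝ → ℝ}, ContDiff ℝ ∞ w → Continuous (derivJet (n := n) w) := fun hw =>
    continuous_pi fun k => continuous_iteratedDeriv_of_smooth hw k
  refine hasJump_iff_of_eqOn (G := Lp ∘ derivJet u) (H := Lm ∘ derivJet v)
    (neg_one_lt_zero (R := ℝ)) one_pos (hLp.comp (hcont hu)) (hLm.comp (hcont hv))
    (fun x hx => ?_) (fun x hx => ?_)
  · rw [hFp x hx.1, hjet isOpen_Ioo hψu hx, Function.comp_apply]
  · rw [hFm x hx.2, hjet isOpen_Ioo hψv hx, Function.comp_apply]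

variable {g ρp ρm μp μm B ξ lam : ℝ}

theorem solvesAt_ofGrowthRate_iff {ρ μ x : ℝ} :
    -(lam ^ 2 * ρ * (|ξ| ^ 2 * ψ x - iteratedDeriv 2 ψ x)) =
      μ * lam *
        (|ξ| ^ 4 * ψ x - 2 * |ξ| ^ 2 * iteratedDeriv 2 ψ x + iteratedDeriv 4 ψ x) +
      |B| ^ 2 * (-(|ξ| ^ 2 * iteratedDeriv 2 ψ x) + iteratedDeriv 4 ψ x) ↔
    (Medium.ofGrowthRate ρ μ B lam).SolvesAt ξ ψ x := by
  rw [show |ξ| ^ 4 = ξ ^ 4 from Even.pow_abs (by decide) ξ, sq_abs, sq_abs, mul_comm μ]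
  rfl

theorem solvesAt_congr_of_eqOn {m : Medium} {w : ℝ → ℝ} {s : Set ℝ} (hs : IsOpen s)
    (h : EqOn ψ w s) {x : ℝ} (hx : x ∈ s) : m.SolvesAt ξ ψ x ↔ m.SolvesAt ξ w x := by
  rw [Medium.SolvesAt, Medium.SolvesAt, h hx, h.iteratedDeriv_of_isOpen hs 2 hx,
    h.iteratedDeriv_of_isOpen hs 4 hx]

variable (hu : ContDiff ℝ ∞ u) (hv : ContDiff ℝ ∞ v) (hψu : EqOn ψ u (Ioo 0 1))
  (hψv : EqOn ψ v (Ioo (-1) 0))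

include hψu hψv

theorem ode_iff_solvesAt :
    (∀ x ∈ Ioo (-1 : ℝ) 0 ∪ Ioo 0 1,
      -(lam ^ 2 * twoPhase ρp ρm x * (|ξ| ^ 2 * ψ x - iteratedDeriv 2 ψ x)) =
        twoPhase μp μm x * lam *
          (|ξ| ^ 4 * ψ x - 2 * |ξ| ^ 2 * iteratedDeriv 2 ψ x + iteratedDeriv 4 ψ x) +
        |B| ^ 2 * (-(|ξ| ^ 2 * iteratedDeriv 2 ψ x) + iteratedDeriv 4 ψ x)) ↔
    (∀ x ∈ Ioo (-1) 0, (Medium.ofGrowthRate ρm μm B lam).SolvesAt ξ v x) ∧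
      ∀ x ∈ Ioo 0 1, (Medium.ofGrowthRate ρp μp B lam).SolvesAt ξ u x := by
  simp only [solvesAt_ofGrowthRate_iff, mem_union, or_imp, forall_and]
  refine and_congr (forall₂_congr fun x hx => ?_) (forall₂_congr fun x hx => ?_)
  · rw [twoPhase_of_nonpos _ _ hx.2.le, twoPhase_of_nonpos _ _ hx.2.le,
      solvesAt_congr_of_eqOn isOpen_Ioo hψv hx]
  · rw [twoPhase_of_pos _ _ hx.1, twoPhase_of_pos _ _ hx.1,
      solvesAt_congr_of_eqOn isOpen_Ioo hψu hx]

include hu hv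

theorem hasJump_deriv_iff {j : ℝ} : HasJump (deriv ψ) j ↔ deriv u 0 - deriv v 0 = j := by
  simpa only [derivJet, Fin.val_one, iteratedDeriv_one] using
    hasJump_iff_derivJet (n := 2) (Lp := (· 1)) (Lm := (· 1)) hu hv hψu hψv (by fun_prop)
      (by fun_prop) (fun x _ => by simp [derivJet]) (fun x _ => by simp [derivJet])

theorem hasJump_moment_iff {j : ℝ} :
    HasJump (fun x => twoPhase μp μm x * lam * (|ξ| ^ 2 * ψ x + iteratedDeriv 2 ψ x) +
      |B| ^ 2 * iteratedDeriv 2 ψ x) j ↔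
    (Medium.ofGrowthRate ρp μp B lam).moment ξ (derivJet u 0) -
      (Medium.ofGrowthRate ρm μm B lam).moment ξ (derivJet v 0) = j := by
  refine hasJump_iff_derivJet hu hv hψu hψv (by unfold Medium.moment; fun_prop)
    (by unfold Medium.moment; fun_prop) (fun x hx => ?_) (fun x hx => ?_)
  · simp [twoPhase_of_pos _ _ hx, Medium.moment, Medium.ofGrowthRate, derivJet, mul_comm lam]
  · simp [twoPhase_of_nonpos _ _ hx.le, Medium.moment, Medium.ofGrowthRate, derivJet,
      mul_comm lam]

theorem hasJump_inertia_iff {j : ℝ} :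
    HasJump (fun x => lam ^ 2 * twoPhase ρp ρm x * deriv ψ x) j ↔
      lam ^ 2 * ρp * deriv u 0 - lam ^ 2 * ρm * deriv v 0 = j := by
  simpa only [derivJet, Fin.val_one, iteratedDeriv_one] using
    hasJump_iff_derivJet (n := 2) (Lp := fun y => lam ^ 2 * ρp * y 1)
      (Lm := fun y => lam ^ 2 * ρm * y 1) hu hv hψu hψv (by fun_prop) (by fun_prop)
      (fun x hx => by simp [twoPhase_of_pos _ _ hx, derivJet])
      (fun x hx => by simp [twoPhase_of_nonpos _ _ hx.le, derivJet])

theorem hasJump_third_iff {j : ℝ} :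
    HasJump (fun x => twoPhase μp μm x * lam * (iteratedDeriv 3 ψ x - 3 * |ξ| ^ 2 * deriv ψ x) +
      |B| ^ 2 * iteratedDeriv 3 ψ x) j ↔
    (μp * lam * (iteratedDeriv 3 u 0 - 3 * ξ ^ 2 * deriv u 0) + B ^ 2 * iteratedDeriv 3 u 0) -
      (μm * lam * (iteratedDeriv 3 v 0 - 3 * ξ ^ 2 * deriv v 0) + B ^ 2 * iteratedDeriv 3 v 0) =
      j := by
  have hval : ((3 : Fin 4) : ℕ) = 3 := rfl
  simpa only [derivJet, Fin.val_one, hval, iteratedDeriv_one] using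
    hasJump_iff_derivJet (n := 4)
      (Lp := fun y => μp * lam * (y 3 - 3 * ξ ^ 2 * y 1) + B ^ 2 * y 3)
      (Lm := fun y => μm * lam * (y 3 - 3 * ξ ^ 2 * y 1) + B ^ 2 * y 3) hu hv hψu hψv
      (by fun_prop) (by fun_prop)
      (fun x hx => by simp [twoPhase_of_pos _ _ hx, derivJet])
      (fun x hx => by simp [twoPhase_of_nonpos _ _ hx.le, derivJet])

theorem exists_hasJump_shear_iff {τ : ℝ} (h1 : deriv u 0 = deriv v 0) :
    (∃ j, HasJump (fun x => lam ^ 2 * twoPhase ρp ρm x * deriv ψ x) j ∧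
      HasJump (fun x => twoPhase μp μm x * lam *
        (iteratedDeriv 3 ψ x - 3 * |ξ| ^ 2 * deriv ψ x) + |B| ^ 2 * iteratedDeriv 3 ψ x) (j + τ)) ↔
    (Medium.ofGrowthRate ρm μm B lam).shear ξ (derivJet v 0) -
      (Medium.ofGrowthRate ρp μp B lam).shear ξ (derivJet u 0) = τ := by
  have hval : ((3 : Fin 4) : ℕ) = 3 := rfl
  simp only [hasJump_inertia_iff hu hv hψu hψv, hasJump_third_iff hu hv hψu hψv, exists_eq_left',
    Medium.shear, Medium.ofGrowthRate, derivJet, Fin.val_one, hval, iteratedDeriv_one, h1]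
  constructor <;> intro h <;> linarith

theorem isNormalMode_iff_isTransmission :
    IsNormalMode g ρp ρm μp μm B ξ ψ lam ↔
      IsTransmission (.ofGrowthRate ρp μp B lam) (.ofGrowthRate ρm μm B lam) ξ
        (g * (ρp - ρm) * ξ ^ 2 * ψ 0) u v ∧ ψ (-1) = 0 ∧ ψ 1 = 0 ∧ ψ 0 = u 0 := by
  rw [← sq_abs ξ]
  have hleft : (-1 : ℝ) < 0 := neg_one_lt_zero
  have hu' := hu.continuous_deriv (by simp)
  have hv' := hv.continuous_deriv (by simp)
  have hψu' := hψu.deriv isOpen_Ioo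
  have hψv' := hψv.deriv isOpen_Ioo
  have hfirst : ∀ p : ℕ → Prop, (∀ i < 2, p i) ↔ p 0 ∧ p 1 := fun p =>
    ⟨fun h => ⟨h 0 two_pos, h 1 one_lt_two⟩, fun h i hi => by interval_cases i; exacts [h.1, h.2]⟩
  have hu4 : ContDiff ℝ 4 u := hu.of_le ENat.LEInfty.out
  have hv4 : ContDiff ℝ 4 v := hv.of_le ENat.LEInfty.out
  constructor
  · rintro ⟨-, -, hode, hcont, hderiv, hmoment, hshear, hl, hr, hlt, hrt, hldt, hrdt⟩
    rw [ode_iff_solvesAt hψu hψv] at hode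
    rw [continuousAt_iff_of_eqOn hleft one_pos hu.continuous hv.continuous hψu hψv] at hcont
    rw [hasJump_deriv_iff hu hv hψu hψv, sub_eq_zero] at hderiv
    rw [hasJump_moment_iff hu hv hψu hψv, sub_eq_zero] at hmoment
    rw [exists_hasJump_shear_iff hu hv hψu hψv hderiv] at hshear
    rw [tendsto_nhdsGT_iff_of_eqOn hleft hv.continuous hψv] at hlt
    rw [tendsto_nhdsLT_iff_of_eqOn one_pos hu.continuous hψu] at hrt
    rw [tendsto_nhdsGT_iff_of_eqOn hleft hv' hψv'] at hldt
    rw [tendsto_nhdsLT_iff_of_eqOn one_pos hu' hψu'] at hrdt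
    refine ⟨⟨hu, hv, hode.2, hode.1, ?_, hmoment, hshear, ?_, ?_⟩, hl, hr, hcont.1⟩ <;>
      simp only [hfirst, iteratedDeriv_zero, iteratedDeriv_one]
    exacts [⟨hcont.1.symm.trans hcont.2, hderiv⟩, ⟨hrt, hrdt⟩, ⟨hlt, hldt⟩]
  · rintro ⟨⟨-, -, hodeu, hodev, hmatch, hmoment, hshear, hright, hleft'⟩, hl, hr, h0⟩
    simp only [hfirst, iteratedDeriv_zero, iteratedDeriv_one] at hmatch hright hleft'
    exact ⟨hv4.contDiffOn.congr hψv, hu4.contDiffOn.congr hψu,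
      (ode_iff_solvesAt hψu hψv).2 ⟨hodev, hodeu⟩,
      (continuousAt_iff_of_eqOn hleft one_pos hu.continuous hv.continuous hψu hψv).2
        ⟨h0, h0.trans hmatch.1⟩,
      (hasJump_deriv_iff hu hv hψu hψv).2 (sub_eq_zero.2 hmatch.2),
      (hasJump_moment_iff hu hv hψu hψv).2 (sub_eq_zero.2 hmoment),
      (exists_hasJump_shear_iff hu hv hψu hψv hmatch.2).2 hshear, hl, hr,
      (tendsto_nhdsGT_iff_of_eqOn hleft hv.continuous hψv).2 hleft'.1,
      (tendsto_nhdsLT_iff_of_eqOn one_pos hu.continuous hψu).2 hright.1,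
      (tendsto_nhdsGT_iff_of_eqOn hleft hv' hψv').2 hleft'.2,
      (tendsto_nhdsLT_iff_of_eqOn one_pos hu' hψu').2 hright.2⟩

end NormalMode

section Correspondence

variable {g ρp ρm μp μm B ξ lam : ℝ} {ψ u v : ℝ → ℝ}

theorem Medium.exists_contDiff_eqOn {m : Medium} (hm : 0 < m.viscosity + m.tension) {a b : ℝ}
    (hψ : ContDiffOn ℝ 4 ψ (Ioo a b)) (hode : ∀ x ∈ Ioo a b, m.SolvesAt ξ ψ x) :
    ∃ w, ContDiff ℝ ∞ w ∧ EqOn ψ w (Ioo a b) := by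
  obtain ⟨y, hy⟩ := exists_eqOn_linearODESolution (m.odeCoeff ξ) (by exact_mod_cast hψ)
    fun x hx => (solvesAt_iff ξ hm).1 (hode x hx)
  exact ⟨_, contDiff_linearODESolution _ y, hy⟩

theorem IsNormalMode.exists_isTransmission (h : IsNormalMode g ρp ρm μp μm B ξ ψ lam)
    (hμp : 0 ≤ μp) (hμm : 0 ≤ μm) (hBp : 0 < μp + B ^ 2) (hBm : 0 < μm + B ^ 2)
    (hlam : 0 < lam) :
    ∃ (u v : ℝ → ℝ) (hT : IsTransmission (.ofGrowthRate ρp μp B lam) (.ofGrowthRate ρm μm B lam) ξ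
      (g * (ρp - ρm) * ξ ^ 2 * ψ 0) u v), ∀ x ∈ Icc (-1) 1, hT.toH20.jet x 0 = ψ x := by
  obtain ⟨hodel, hodeu⟩ := (ode_iff_solvesAt (eqOn_refl _ _) (eqOn_refl _ _)).1 h.ode
  obtain ⟨u, hu, hψu⟩ := Medium.exists_contDiff_eqOn
    (Medium.stiffness_ofGrowthRate_pos hμp hBp hlam) h.contDiffOn_upper hodeu
  obtain ⟨v, hv, hψv⟩ := Medium.exists_contDiff_eqOn
    (Medium.stiffness_ofGrowthRate_pos hμm hBm hlam) h.contDiffOn_lower hodel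
  obtain ⟨hT, -, -, h0⟩ := (isNormalMode_iff_isTransmission hu hv hψu hψv).1 h
  refine ⟨u, v, hT, fun x hx => ?_⟩
  rcases hx.1.eq_or_lt with rfl | hx1
  · rw [hT.toH20.isH20.fst.left_eq_zero, h.left_eq_zero]
  rcases hx.2.eq_or_lt with rfl | hx2
  · rw [hT.toH20.isH20.fst.right_eq_zero, h.right_eq_zero]
  rcases lt_trichotomy x 0 with hneg | rfl | hpos
  · exact (hT.eqOn_lower hneg.le).trans (hψv ⟨hx1, hneg⟩).symm
  · rw [hT.toH20_jet_zero, h0]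
  · exact (hT.eqOn_upper hpos).trans (hψu ⟨hpos, hx2⟩).symm

namespace IsTransmission

variable {mp mm : Medium} {τ : ℝ}

theorem contDiffOn_toH20_upper (h : IsTransmission mp mm ξ τ u v) :
    ContDiffOn ℝ ∞ (h.toH20.jet · 0) (Ioo 0 1) :=
  h.contDiff_upper.contDiffOn.congr (h.eqOn_upper.mono Ioo_subset_Ioi_self)

theorem contDiffOn_toH20_lower (h : IsTransmission mp mm ξ τ u v) :
    ContDiffOn ℝ ∞ (h.toH20.jet · 0) (Ioo (-1) 0) :=
  h.contDiff_lower.contDiffOn.congr (h.eqOn_lower.mono fun _ hx => hx.2.le)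

theorem isNormalMode (h : IsTransmission (.ofGrowthRate ρp μp B lam) (.ofGrowthRate ρm μm B lam) ξ
    τ u v) (hτ : g * (ρp - ρm) * ξ ^ 2 * h.toH20.jet 0 0 = τ) :
    IsNormalMode g ρp ρm μp μm B ξ (h.toH20.jet · 0) lam :=
  (isNormalMode_iff_isTransmission h.contDiff_upper h.contDiff_lower
    (h.eqOn_upper.mono Ioo_subset_Ioi_self) (h.eqOn_lower.mono fun _ hx => hx.2.le)).2
    ⟨by simpa only [hτ] using h, h.toH20.isH20.fst.left_eq_zero,
      h.toH20.isH20.fst.right_eq_zero, h.toH20_jet_zero⟩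

end IsTransmission

end Correspondence

/-- A polynomial on `[0,1]` whose slope `(1 - x)^(n+1) + x^(n+1) - 1` vanishes at both end points
and tends to `-1` inside, so that it approximates the tent `1 - x`. -/
noncomputable def tentProfile (n : ℕ) (x : ℝ) : ℝ :=
  1 - x - ((1 - x) ^ (n + 2) + 1 - x ^ (n + 2)) / (n + 2)

theorem contDiff_tentProfile (n : ℕ) {k : WithTop ℕ∞} : ContDiff ℝ k (tentProfile n) := by
  unfold tentProfile
  fun_prop

theorem deriv_tentProfile (n : ℕ) (x : ℝ) :
    deriv (tentProfile n) x = (1 - x) ^ (n + 1) + x ^ (n + 1) - 1 := by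
  have hne : (n : ℝ) + 2 ≠ 0 := by positivity
  have hsub : HasDerivAt (fun y : ℝ => 1 - y) (-1) x := (hasDerivAt_id x).const_sub 1
  refine (hsub.sub ((((hsub.fun_pow (n + 2)).add_const 1).sub
    (hasDerivAt_pow (n + 2) x)).div_const (n + 2))).deriv.trans ?_
  push_cast
  field_simp
  ring

theorem deriv_tentProfile_sq_le_one (n : ℕ) {x : ℝ} (hx : x ∈ Icc 0 1) :
    deriv (tentProfile n) x ^ 2 ≤ 1 := by
  have h0 : 0 ≤ 1 - x := sub_nonneg.2 hx.2
  have hpow := pow_le_of_le_one hx.1 hx.2 n.add_one_ne_zero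
  have hpow' := pow_le_of_le_one h0 (by linarith [hx.1]) n.add_one_ne_zero
  rw [deriv_tentProfile, sq_le_one_iff_abs_le_one, abs_le]
  constructor
  · linarith [pow_nonneg hx.1 (n + 1), pow_nonneg h0 (n + 1)]
  · linarith

theorem deriv_comp_neg_tentProfile (n : ℕ) (x : ℝ) :
    deriv (fun y => tentProfile n (-y)) x = -deriv (tentProfile n) (-x) :=
  deriv_comp_neg _ _

namespace H20

/-- The smoothed tent `tentProfile n |x|`. -/
noncomputable def tent (n : ℕ) : H20 :=
  .glue (tentProfile n) (fun x => tentProfile n (-x)) (contDiff_tentProfile n)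
    ((contDiff_tentProfile n).comp contDiff_neg)
    (fun i hi => by
      interval_cases i <;> simp [deriv_comp_neg_tentProfile, deriv_tentProfile])
    (fun i hi => by interval_cases i <;> simp [tentProfile, deriv_tentProfile])
    (fun i hi => by
      interval_cases i
      · simp [tentProfile]
      · simp [deriv_comp_neg_tentProfile, deriv_tentProfile])

theorem tent_jet_zero (n : ℕ) : (tent n).jet 0 0 = 1 - 2 / ((n : ℝ) + 2) := by
  simp [tent, glue, twoPhase_of_nonpos, tentProfile, one_add_one_eq_two]

theorem tent_jet_one_sq_le_one (n : ℕ) {x : ℝ} (hx : x ∈ Ioo (-1) 1) :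
    (tent n).jet x 1 ^ 2 ≤ 1 := by
  rcases le_or_gt x 0 with h | h
  · simpa [tent, glue, twoPhase_of_nonpos _ _ h, deriv_comp_neg_tentProfile] using
      deriv_tentProfile_sq_le_one n ⟨neg_nonneg.2 h, by linarith [hx.1]⟩
  · simpa [tent, glue, twoPhase_of_pos _ _ h] using
      deriv_tentProfile_sq_le_one n ⟨h.le, hx.2.le⟩

theorem integral_tent_jet_one_sq_le (n : ℕ) :
    ∫ x in Ioo (-1 : ℝ) 1, (tent n).jet x 1 ^ 2 ≤ 2 := calc
  _ ≤ ∫ _ in Ioo (-1 : ℝ) 1, (1 : ℝ) :=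
    setIntegral_mono_on ((tent n).integrableOn_jet_sq 1) (integrableOn_const (by simp))
      measurableSet_Ioo fun _ hx => tent_jet_one_sq_le_one n hx
  _ = 2 := by norm_num

theorem exists_mul_integral_sq_lt {b G : ℝ} (hb : 0 ≤ b) (hG : 2 * b < G) :
    ∃ a : H20, b * ∫ x in Ioo (-1 : ℝ) 1, a.jet x 1 ^ 2 < G * a.jet 0 0 ^ 2 := by
  have hlim : Tendsto (fun n : ℕ => G * (tent n).jet 0 0 ^ 2) atTop (𝓝 G) := by
    have hdiv : Tendsto (fun n : ℕ => 2 / ((n : ℝ) + 2)) atTop (𝓝 0) :=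
      (tendsto_atTop_add_const_right _ _ tendsto_natCast_atTop_atTop).const_div_atTop 2
    simpa [tent_jet_zero] using ((hdiv.const_sub 1).pow 2).const_mul G
  obtain ⟨n, hn⟩ := (hlim.eventually_const_lt hG).exists
  refine ⟨tent n, lt_of_le_of_lt ?_ hn⟩
  rw [mul_comm 2]
  exact mul_le_mul_of_nonneg_left (integral_tent_jet_one_sq_le n) hb

end H20

section Critical

variable {g ρp ρm B ξ : ℝ} {ψ ψ' : ℝ → ℝ}

theorem IsH10.mul_sq_div_integral_sq_le (h : IsH10 ψ ψ') (G : ℝ)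
    (hpos : 0 < ∫ x in Ioo (-1 : ℝ) 1, ψ' x ^ 2) :
    G * ψ 0 ^ 2 / ∫ x in Ioo (-1 : ℝ) 1, ψ' x ^ 2 ≤ max G 0 / 2 := by
  rw [div_le_div_iff₀ hpos two_pos]
  have hmax := mul_le_mul_of_nonneg_right (le_max_left G 0) (sq_nonneg (ψ 0))
  linarith [mul_le_mul_of_nonneg_left h.two_mul_sq_le (le_max_right G 0)]

theorem two_mul_sq_lt_of_lt_criticalMagneticNumber (hB : |B| < criticalMagneticNumber g ρp ρm) :
    2 * B ^ 2 < g * (ρp - ρm) := by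
  have hle : criticalMagneticNumber g ρp ρm ≤ √(max (g * (ρp - ρm)) 0 / 2) := by
    refine Real.sqrt_le_sqrt (Real.sSup_le ?_ (by positivity))
    rintro r ⟨φ, φ', hφ, hpos, rfl⟩
    exact hφ.mul_sq_div_integral_sq_le _ hpos
  have hlt := (Real.lt_sqrt (abs_nonneg B)).1 (hB.trans_le hle)
  rw [sq_abs, lt_div_iff₀ two_pos, mul_comm, lt_max_iff] at hlt
  exact hlt.resolve_right (by positivity : 0 ≤ 2 * B ^ 2).not_gt

theorem IsH10.mul_sq_le_of_criticalMagneticNumber_le (hB : criticalMagneticNumber g ρp ρm ≤ |B|)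
    (h : IsH10 ψ ψ') :
    g * (ρp - ρm) * ψ 0 ^ 2 ≤ B ^ 2 * ∫ x in Ioo (-1 : ℝ) 1, ψ' x ^ 2 := by
  rcases le_or_gt (∫ x in Ioo (-1 : ℝ) 1, ψ' x ^ 2) 0 with hnonpos | hpos
  · rw [h.eq_zero_of_integral_sq_nonpos hnonpos (by norm_num : (0 : ℝ) ∈ Icc (-1) 1)]
    simpa using mul_nonneg (sq_nonneg B) (integral_nonneg fun x => sq_nonneg (ψ' x))
  · rw [criticalMagneticNumber, Real.sqrt_le_left (abs_nonneg B), sq_abs] at hB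
    rw [← div_le_iff₀ hpos]
    refine le_trans ?_ hB
    refine le_csSup ⟨max (g * (ρp - ρm)) 0 / 2, ?_⟩ ⟨ψ, ψ', h, hpos, rfl⟩
    rintro r ⟨φ, φ', hφ, hφpos, rfl⟩
    exact hφ.mul_sq_div_integral_sq_le _ hφpos

namespace H20

theorem mul_sq_le_tension_of_criticalMagneticNumber_le
    (hB : criticalMagneticNumber g ρp ρm ≤ |B|) (ξ : ℝ) (a : H20) :
    g * (ρp - ρm) * ξ ^ 2 * a.jet 0 0 ^ 2 ≤ B ^ 2 * energy a a ⟨0, 0, 1⟩ ⟨0, 0, 1⟩ ξ := by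
  have hsecond : 0 ≤ B ^ 2 * ∫ x in Ioo (-1 : ℝ) 1, a.jet x 2 ^ 2 :=
    mul_nonneg (sq_nonneg B) (integral_nonneg fun x => sq_nonneg _)
  rw [energy_tension]
  linarith [mul_le_mul_of_nonneg_left
    (a.isH20.fst.mul_sq_le_of_criticalMagneticNumber_le hB) (sq_nonneg ξ)]

theorem mul_sq_le_tension_of_le_verticalCriticalFrequency
    (hξ : |ξ| ≤ verticalCriticalFrequency g ρp ρm B) (a : H20) :
    g * (ρp - ρm) * ξ ^ 2 * a.jet 0 0 ^ 2 ≤ B ^ 2 * energy a a ⟨0, 0, 1⟩ ⟨0, 0, 1⟩ ξ := by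
  have hsecond : 0 ≤ B ^ 2 * ∫ x in Ioo (-1 : ℝ) 1, a.jet x 2 ^ 2 :=
    mul_nonneg (sq_nonneg B) (integral_nonneg fun x => sq_nonneg _)
  rw [energy_tension]
  rcases le_or_gt (g * (ρp - ρm) * a.jet 0 0 ^ 2 -
      |B| ^ 2 * ∫ x in Ioo (-1 : ℝ) 1, a.jet x 1 ^ 2) 0 with hnonpos | hpos
  · rw [sq_abs] at hnonpos
    linarith [mul_nonpos_of_nonneg_of_nonpos (sq_nonneg ξ) hnonpos]
  · have hlower : (0 : ℝ) ∈ lowerBounds {r : ℝ | ∃ ψ ψ' ψ'' : ℝ → ℝ, IsH20 ψ ψ' ψ'' ∧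
        0 < g * (ρp - ρm) * ψ 0 ^ 2 - |B| ^ 2 * ∫ x in Ioo (-1 : ℝ) 1, ψ' x ^ 2 ∧
        r = (|B| ^ 2 * ∫ x in Ioo (-1 : ℝ) 1, ψ'' x ^ 2) /
          (g * (ρp - ρm) * ψ 0 ^ 2 - |B| ^ 2 * ∫ x in Ioo (-1 : ℝ) 1, ψ' x ^ 2)} := by
      rintro r ⟨φ, φ', φ'', -, hφ, rfl⟩
      exact div_nonneg (mul_nonneg (sq_nonneg _) (integral_nonneg fun x => sq_nonneg _)) hφ.le
    rw [verticalCriticalFrequency, Real.le_sqrt (abs_nonneg ξ)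
      (Real.sInf_nonneg fun r hr => hlower hr), sq_abs] at hξ
    have hle := hξ.trans (csInf_le ⟨0, hlower⟩ ⟨_, _, _, a.isH20, hpos, rfl⟩)
    rw [le_div_iff₀ hpos, sq_abs] at hle
    linarith

theorem exists_tension_lt (hB : |B| < criticalMagneticNumber g ρp ρm)
    (hξ : verticalCriticalFrequency g ρp ρm B < |ξ|) :
    ∃ a : H20, B ^ 2 * energy a a ⟨0, 0, 1⟩ ⟨0, 0, 1⟩ ξ <
      g * (ρp - ρm) * ξ ^ 2 * a.jet 0 0 ^ 2 := by
  have hsq := (Real.sqrt_lt' ((Real.sqrt_nonneg _).trans_lt hξ)).1 hξ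
  obtain ⟨a, ha⟩ := exists_mul_integral_sq_lt (sq_nonneg B)
    (two_mul_sq_lt_of_lt_criticalMagneticNumber hB)
  obtain ⟨_, ⟨φ, φ', φ'', hφ, hpos, rfl⟩, hlt⟩ := exists_lt_of_csInf_lt
    (by exact ⟨_, _, _, _, a.isH20, by rwa [sq_abs, sub_pos], rfl⟩) hsq
  refine ⟨⟨fun x => ![φ x, φ' x, φ'' x], hφ⟩, ?_⟩
  rw [div_lt_iff₀ hpos, sq_abs, sq_abs] at hlt
  rw [energy_tension]
  simp only [Matrix.cons_val]
  linarith

end H20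

end Critical

section Variational

variable {g ρp ρm μp μm B ξ lam : ℝ} {ψ : ℝ → ℝ}

theorem IsNormalMode.eq_zero (h : IsNormalMode g ρp ρm μp μm B ξ ψ lam) (hρp : 0 < ρp)
    (hρm : 0 < ρm) (hμp : 0 ≤ μp) (hμm : 0 ≤ μm) (hBp : 0 < μp + B ^ 2) (hBm : 0 < μm + B ^ 2)
    (hlam : 0 < lam) (hstable : ∀ a : H20, g * (ρp - ρm) * ξ ^ 2 * a.jet 0 0 ^ 2 ≤
      B ^ 2 * a.energy a ⟨0, 0, 1⟩ ⟨0, 0, 1⟩ ξ) {x : ℝ} (hx : x ∈ Icc (-1) 1) : ψ x = 0 := by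
  obtain ⟨u, v, hT, heq⟩ := h.exists_isTransmission hμp hμm hBp hBm hlam
  rw [← heq x hx]
  have hinterface : hT.toH20.jet 0 0 = ψ 0 := heq 0 (by norm_num)
  have henergy := calc
    hT.toH20.energy hT.toH20 (.ofGrowthRate ρp μp B lam) (.ofGrowthRate ρm μm B lam) ξ
      = g * (ρp - ρm) * ξ ^ 2 * ψ 0 * hT.toH20.jet 0 0 := hT.energy_eq _
    _ = g * (ρp - ρm) * ξ ^ 2 * hT.toH20.jet 0 0 ^ 2 := by rw [hinterface]; ring
    _ ≤ B ^ 2 * hT.toH20.energy hT.toH20 ⟨0, 0, 1⟩ ⟨0, 0, 1⟩ ξ := hstable _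
  exact H20.eq_zero_of_energy_ofGrowthRate_le hρp hρm hμp hμm hlam henergy hx

theorem isResponse_of_isTransmission (hρp : 0 ≤ ρp) (hρm : 0 ≤ ρm) (hμp : 0 ≤ μp) (hμm : 0 ≤ μm)
    {w : ℝ → H20} (hw : ∀ t > 0, ∃ (u v : ℝ → ℝ) (hT : IsTransmission (.ofGrowthRate ρp μp B t)
      (.ofGrowthRate ρm μm B t) ξ 1 u v), hT.toH20 = w t) :
    IsResponse (fun a : H20 => a.energy a ⟨ρp, 0, 0⟩ ⟨ρm, 0, 0⟩ ξ)
      (fun a => a.energy a ⟨0, μp, 0⟩ ⟨0, μm, 0⟩ ξ)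
      (fun a => B ^ 2 * a.energy a ⟨0, 0, 1⟩ ⟨0, 0, 1⟩ ξ) (fun a => a.jet 0 0) w := by
  have hunit : (Medium.mk 0 0 1).Nonneg := ⟨le_rfl, le_rfl, zero_le_one⟩
  have hload : ∀ t > 0, ∀ b : H20, (w t).energy b (.ofGrowthRate ρp μp B t)
      (.ofGrowthRate ρm μm B t) ξ = b.jet 0 0 := by
    intro t ht b
    obtain ⟨u, v, hT, hTw⟩ := hw t ht
    rw [← hTw, hT.energy_eq, one_mul]
  refine ⟨fun a => a.energy_self_nonneg ξ ⟨hρp, le_rfl, le_rfl⟩ ⟨hρm, le_rfl, le_rfl⟩,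
    fun a => a.energy_self_nonneg ξ ⟨le_rfl, hμp, le_rfl⟩ ⟨le_rfl, hμm, le_rfl⟩,
    fun a => mul_nonneg (sq_nonneg B) (a.energy_self_nonneg ξ hunit hunit),
    fun t ht => ?_, fun t ht b => ?_⟩
  · rw [pencil, ← H20.energy_ofGrowthRate, hload t ht]
  · rw [pencil, ← H20.energy_ofGrowthRate, ← hload t ht b, ← hload t ht (w t)]
    exact (w t).energy_sq_le_mul b ξ (Medium.nonneg_ofGrowthRate hρp hμp B ht.le)
      (Medium.nonneg_ofGrowthRate hρm hμm B ht.le)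

theorem exists_isNormalMode (hρp : 0 < ρp) (hρm : 0 < ρm) (hμp : 0 ≤ μp) (hμm : 0 ≤ μm)
    (hBp : 0 < μp + B ^ 2) (hBm : 0 < μm + B ^ 2) {φ : H20}
    (hφ : B ^ 2 * φ.energy φ ⟨0, 0, 1⟩ ⟨0, 0, 1⟩ ξ < g * (ρp - ρm) * ξ ^ 2 * φ.jet 0 0 ^ 2) :
    ∃ (ψ : ℝ → ℝ) (lam : ℝ), 0 < lam ∧ IsNormalMode g ρp ρm μp μm B ξ ψ lam ∧
      ContDiffOn ℝ ∞ ψ (Ioo (-1) 0) ∧ ContDiffOn ℝ ∞ ψ (Ioo 0 1) ∧ ψ 0 ≠ 0 := by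
  have hsolve : ∀ t : ℝ, ∃ w : H20, 0 < t → ∃ (u v : ℝ → ℝ) (hT : IsTransmission
      (.ofGrowthRate ρp μp B t) (.ofGrowthRate ρm μm B t) ξ 1 u v), hT.toH20 = w := by
    intro t
    rcases le_or_gt t 0 with ht | ht
    · exact ⟨φ, fun h => absurd h ht.not_gt⟩
    · obtain ⟨u, v, hT⟩ := Medium.exists_isTransmission
        (Medium.nonneg_ofGrowthRate hρp.le hμp B ht.le)
        (Medium.nonneg_ofGrowthRate hρm.le hμm B ht.le)
        (mul_pos (pow_pos ht 2) hρp) (mul_pos (pow_pos ht 2) hρm)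
        (Medium.stiffness_ofGrowthRate_pos hμp hBp ht)
        (Medium.stiffness_ofGrowthRate_pos hμm hBm ht) ξ 1
      exact ⟨hT.toH20, fun _ => ⟨u, v, hT, rfl⟩⟩
  choose w hw using hsolve
  have hmin : 0 < min ρp ρm := lt_min hρp hρm
  obtain ⟨t, ht, hcrit⟩ := (isResponse_of_isTransmission hρp.le hρm.le hμp hμm
    hw).exists_mul_compliance_eq_one (mul_pos two_pos hmin)
    (fun a => a.mul_sq_le_energy ξ hmin.le ⟨hρp.le, le_rfl, le_rfl⟩ ⟨hρm.le, le_rfl, le_rfl⟩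
      (min_le_left _ _) (min_le_right _ _)) hφ
  obtain ⟨u, v, hT, hTw⟩ := hw t ht
  rw [← hTw] at hcrit
  exact ⟨_, t, ht, hT.isNormalMode hcrit, hT.contDiffOn_toH20_lower, hT.contDiffOn_toH20_upper,
    right_ne_zero_of_mul_eq_one hcrit⟩

theorem IsNormalMode.of_abs (h : IsNormalMode g ρp ρm μp μm B |ξ| ψ lam) :
    IsNormalMode g ρp ρm μp μm B ξ ψ lam :=
  { h with
    ode := by simpa only [abs_abs] using h.ode
    jump_second := by simpa only [abs_abs] using h.jump_second
    jump_third := by simpa only [abs_abs] using h.jump_third }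

end Variational

theorem theorem2p1_general (g ρp ρm μp μm B : ℝ) (hρp : 0 < ρp) (hρm : 0 < ρm) (hμp : 0 ≤ μp)
    (hμm : 0 ≤ μm) (hBp : 0 < μp + B ^ 2) (hBm : 0 < μm + B ^ 2) :
    (criticalMagneticNumber g ρp ρm ≤ |B| →
      ∀ (ξ lam : ℝ) (ψ : ℝ → ℝ), 0 < lam → IsNormalMode g ρp ρm μp μm B ξ ψ lam →
        ∀ x ∈ Icc (-1 : ℝ) 1, ψ x = 0) ∧
    (|B| < criticalMagneticNumber g ρp ρm →
      ∀ ξ : ℝ, |ξ| ≤ verticalCriticalFrequency g ρp ρm B →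
        ∀ (lam : ℝ) (ψ : ℝ → ℝ), 0 < lam → IsNormalMode g ρp ρm μp μm B ξ ψ lam →
          ∀ x ∈ Icc (-1 : ℝ) 1, ψ x = 0) ∧
    (|B| < criticalMagneticNumber g ρp ρm →
      ∃ (ψ : ℝ → ℝ → ℝ) (lam : ℝ → ℝ),
        ∀ ξ : ℝ, verticalCriticalFrequency g ρp ρm B < |ξ| →
          0 < lam ξ ∧ IsNormalMode g ρp ρm μp μm B ξ (ψ ξ) (lam ξ) ∧
          ψ (-ξ) = ψ ξ ∧ lam (-ξ) = lam ξ ∧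
          ContDiffOn ℝ ∞ (ψ ξ) (Ioo (-1) 0) ∧ ContDiffOn ℝ ∞ (ψ ξ) (Ioo 0 1) ∧
          ψ ξ 0 ≠ 0) := by
  refine ⟨fun hB ξ lam ψ hlam hψ x => hψ.eq_zero hρp hρm hμp hμm hBp hBm hlam
      (H20.mul_sq_le_tension_of_criticalMagneticNumber_le hB ξ),
    fun _ ξ hξ lam ψ hlam hψ x => hψ.eq_zero hρp hρm hμp hμm hBp hBm hlam
      (H20.mul_sq_le_tension_of_le_verticalCriticalFrequency hξ), fun hB => ?_⟩
  have hmode : ∀ r : ℝ, ∃ (ψ : ℝ → ℝ) (lam : ℝ), verticalCriticalFrequency g ρp ρm B < |r| →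
      0 < lam ∧ IsNormalMode g ρp ρm μp μm B r ψ lam ∧
        ContDiffOn ℝ ∞ ψ (Ioo (-1) 0) ∧ ContDiffOn ℝ ∞ ψ (Ioo 0 1) ∧ ψ 0 ≠ 0 := by
    intro r
    by_cases hr : verticalCriticalFrequency g ρp ρm B < |r|
    · obtain ⟨φ, hφ⟩ := H20.exists_tension_lt hB hr
      obtain ⟨ψ, lam, h⟩ := exists_isNormalMode hρp hρm hμp hμm hBp hBm hφ
      exact ⟨ψ, lam, fun _ => h⟩
    · exact ⟨0, 0, fun h => absurd h hr⟩
  choose ψ lam h using hmode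
  refine ⟨fun ξ => ψ |ξ|, fun ξ => lam |ξ|, fun ξ hξ => ?_⟩
  obtain ⟨hlam, hψ, hrest⟩ := h |ξ| (by rwa [abs_abs])
  exact ⟨hlam, hψ.of_abs, by simp only [abs_neg], by simp only [abs_neg], hrest⟩

theorem theorem2p1 (g ρp ρm μp μm B : ℝ) (hg : 0 < g) (hρm : 0 < ρm) (hρ : ρm < ρp)
    (hμp : 0 < μp) (hμm : 0 < μm) :
    (criticalMagneticNumber g ρp ρm ≤ |B| →
      ∀ (ξ lam : ℝ) (ψ : ℝ → ℝ), 0 < lam → IsNormalMode g ρp ρm μp μm B ξ ψ lam →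
        ∀ x ∈ Icc (-1 : ℝ) 1, ψ x = 0) ∧
    (|B| < criticalMagneticNumber g ρp ρm →
      ∀ ξ : ℝ, |ξ| ≤ verticalCriticalFrequency g ρp ρm B →
        ∀ (lam : ℝ) (ψ : ℝ → ℝ), 0 < lam → IsNormalMode g ρp ρm μp μm B ξ ψ lam →
          ∀ x ∈ Icc (-1 : ℝ) 1, ψ x = 0) ∧
    (|B| < criticalMagneticNumber g ρp ρm →
      ∃ (ψ : ℝ → ℝ → ℝ) (lam : ℝ → ℝ),
        ∀ ξ : ℝ, verticalCriticalFrequency g ρp ρm B < |ξ| →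
          0 < lam ξ ∧ IsNormalMode g ρp ρm μp μm B ξ (ψ ξ) (lam ξ) ∧
          ψ (-ξ) = ψ ξ ∧ lam (-ξ) = lam ξ ∧
          ContDiffOn ℝ ∞ (ψ ξ) (Ioo (-1) 0) ∧ ContDiffOn ℝ ∞ (ψ ξ) (Ioo 0 1) ∧
          ψ ξ 0 ≠ 0) :=
  theorem2p1_general g ρp ρm μp μm B (hρm.trans hρ) hρm hμp.le hμm.le (by positivity)
    (by positivity)
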